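/- Fix $\beta\in(0,\infty)$. In the linear reliability channel (LRC) with parameter $\beta$ and block length $n$, a permutation $T$ of $\{1,\dots,n\}$ is drawn uniformly at random, independently of the input $X^n\in\{0,1\}^n$, and, given $T=\tau$, the output $Y^n\in\{0,1\}^n$ is obtained by flipping the bits of $X^n$ independently, bit $i$ with probability $q_{\tau(i)}$, where $q_j=\frac{e^{-\beta j/n}}{1+e^{-\beta j/n}}$. The soft-decision noise effect $N^n$ is $X^n+Y^n$ (sum modulo 2) distributed according to its conditional law given $T=\tau_n$, $$p_{N^n}(x)=\prod_{i:\,x_i=1}q_{\tau_n(i)}\prod_{i:\,x_i=0}\bigl(1-q_{\tau_n(i)}\bigr),$$ where $\tau_n$ is the realization of $T$; the hard-decision noise effect $Z^n$ is $X^n+Y^n$ distributed according to its unconditional law, $p_{Z^n}(x)=\frac1{n!}\sum_{\tau\in S_n}P(X^n+Y^n=x\mid T=\tau)$. For a random sequence $X^n$ with finitely many values, let $H_\alpha(X^n)=\frac1{1-\alpha}\ln\sum_x P(X^n=x)^\alpha$ for $\alpha\in(0,1)\cup(1,\infty)$ be its Rényi entropy and $H_1(X^n)=-\sum_x P(X^n=x)\ln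 P(X^n=x)$ its Shannon entropy (in nats), and let $H_\alpha(X)=\lim_{n\to\infty}\frac1n H_\alpha(X^n)$ be the entropy rate. Then, for every $\alpha>0$, the limits $H_\alpha(N)$ and $H_\alpha(Z)$ exist, $H_\alpha(N)$ does not depend on the realizations $(\tau_n)_n$, and $$H_\alpha(N)<H_\alpha(Z).$$ In particular, the soft-decision capacity strictly exceeds the hard-decision capacity: in bits per transmitted symbol, the capacities $$C_N=\lim_{n\to\infty}\frac1n\sup_{p_{X^n}}I(X^n;(Y^n,T)),\qquad C_Z=\lim_{n\to\infty}\frac1n\sup_{p_{X^n}}I(X^n;Y^n)$$ exist, they satisfy $C_N=1-H_1(N)/\ln 2$ and $C_Z=1-H_1(Z)/\ln 2$, and $C_Z<C_N$. -/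

import Mathlib

open Filter Topology

namespace LRC

noncomputable section

/-! ### Entropies of probability mass functions on a finite set -/

/-- Rényi entropy of order `α` (in nats) of the probability mass function `p` on a finite set;
for `α = 1` it is the Shannon entropy. -/
def renyiEntropy {A : Type*} [Fintype A] (α : ℝ) (p : A → ℝ) : ℝ :=
  if α = 1 then -∑ x, p x * Real.log (p x)
  else 1 / (1 - α) * Real.log (∑ x, p x ^ α)

/-- `h` is the Rényi entropy rate of order `α` (in nats) of the process whose `n`-th binary
sequence has probability mass function `P n`: the limit of `H_α(X^n) / n` exists and is `h`. -/
def HasRenyiEntropyRate (P : (n : ℕ) → (Fin n → ZMod 2) → ℝ) (α h : ℝ) : Prop :=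
  Tendsto (fun n : ℕ => renyiEntropy α (P n) / n) atTop (𝓝 h)

/-! ### Capacity of discrete channels -/

/-- Mutual information (in bits) between the input and the output of a discrete channel with
transition probabilities `W a b = P(output = b | input = a)`, for input distribution `p`. -/
def mutualInfo {A B : Type*} [Fintype A] [Fintype B] (W : A → B → ℝ) (p : A → ℝ) : ℝ :=
  ∑ a, ∑ b, p a * W a b * Real.logb 2 (W a b / ∑ a', p a' * W a' b)

/-- Information capacity (in bits per use) of a discrete channel: the supremum of the mutual
information over all input distributions. -/
def capacity {A B : Type*} [Fintype A] [Fintype B] (W : A → B → ℝ) : ℝ :=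
  sSup (mutualInfo W '' stdSimplex ℝ A)

/-- `C` is the asymptotic capacity, in bits per transmitted symbol, of the sequence of block
channels `W n` with binary inputs of length `n`. -/
def HasCapacity {B : ℕ → Type*} [∀ n, Fintype (B n)]
    (W : (n : ℕ) → (Fin n → ZMod 2) → B n → ℝ) (C : ℝ) : Prop :=
  Tendsto (fun n : ℕ => capacity (W n) / n) atTop (𝓝 C)

/-! ### The linear reliability channel -/

/-- Bit-flip probability of the `j`-th least reliable position. Positions are numbered from `0`
in `Fin n`, so `j : Fin n` stands for the position `j + 1` of `{1, …, n}`. -/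
def flipProb (β : ℝ) (n : ℕ) (j : Fin n) : ℝ :=
  Real.exp (-β * ((j : ℝ) + 1) / n) / (1 + Real.exp (-β * ((j : ℝ) + 1) / n))

/-- Probability that the channel outputs `y` on input `x` when the reliability ordering
permutation is `τ`: bit `i` is flipped, independently of the others, with probability
`flipProb β n (τ i)`. -/
def transition (β : ℝ) (n : ℕ) (τ : Equiv.Perm (Fin n)) (x y : Fin n → ZMod 2) : ℝ :=
  ∏ i, if y i ≠ x i then flipProb β n (τ i) else 1 - flipProb β n (τ i)

/-- The channel seen by a soft-decision decoder: the permutation is drawn uniformly at random,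
and the output is the received word together with the permutation. -/
def softChannel (β : ℝ) (n : ℕ) (x : Fin n → ZMod 2)
    (o : (Fin n → ZMod 2) × Equiv.Perm (Fin n)) : ℝ :=
  1 / (n.factorial : ℝ) * transition β n o.2 x o.1

/-- The channel seen by a hard-decision decoder: the permutation is drawn uniformly at random,
and the output is the received word only. -/
def hardChannel (β : ℝ) (n : ℕ) (x y : Fin n → ZMod 2) : ℝ :=
  1 / (n.factorial : ℝ) * ∑ τ : Equiv.Perm (Fin n), transition β n τ x y

/-- Probability mass function of the soft-decision noise effect: the sum of input and output
given that the reliability ordering permutation is `τ`. -/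
def softNoise (β : ℝ) (n : ℕ) (τ : Equiv.Perm (Fin n)) (e : Fin n → ZMod 2) : ℝ :=
  ∏ i, if e i = 1 then flipProb β n (τ i) else 1 - flipProb β n (τ i)

/-- Probability mass function of the hard-decision noise effect: the sum of input and output
when the reliability ordering permutation is uniformly distributed. -/
def hardNoise (β : ℝ) (n : ℕ) (e : Fin n → ZMod 2) : ℝ :=
  1 / (n.factorial : ℝ) * ∑ τ : Equiv.Perm (Fin n), softNoise β n τ e

/-- Whatever the input `x` is, `softNoise` is the law of input plus output given `τ`. -/
theorem transition_add (β : ℝ) (n : ℕ) (τ : Equiv.Perm (Fin n)) (x e : Fin n → ZMod 2) :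
    transition β n τ x (x + e) = softNoise β n τ e := by
  have key : ∀ a : ZMod 2, a ≠ 0 ↔ a = 1 := by decide
  refine Finset.prod_congr rfl fun i _ => ?_
  simp [key]

/-- Whatever the input `x` is, `hardNoise` is the law of input plus output. -/
theorem hardChannel_add (β : ℝ) (n : ℕ) (x e : Fin n → ZMod 2) :
    hardChannel β n x (x + e) = hardNoise β n e := by
  simp [hardChannel, hardNoise, transition_add]

end

end LRC

/-! In terms of log-odds, the soft noise is a product of Bernoulli laws with parameters σ(-βj/n), so
its Rényi entropy is a sum over positions. This sum is invariant under permutations and, divided by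
n, is a Riemann sum. This gives the soft rate as an integral over t in [0,1].

The hard noise is invariant under permutations, hence uniform on each weight class
(`hardNoise_eq_div`). The sum of its α-th powers is Σ_w C(n,w)^(1-α) P(w)^α, where P is the law of
the weight. Its n+1 terms are governed by the largest exponent sup_θ [(1-α) h(θ) - α J(θ)] - α Λ(0).
Here h is the binary entropy, Λ(s) the limiting log-partition function and J its Legendre transform.
The upper bound is Chernoff's (`log_weightProb_le`). The lower bound is Gibbs' inequality with the
exponentially tilted weight law as trial distribution (`le_log_sum_hardTerm`), combined with a
variance bound. For α = 1 the weight itself has entropy at most log(n+1), which leaves the rate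
h(mean).

Strictness comes from concavity of h. For α = 1 it is strict Jensen for t ↦ σ(-βt). For α < 1 the
exponent is evaluated at the mean weight of the law with log-odds -αβt, and strict Jensen applies
again. For α > 1 all θ must be beaten uniformly. There the deficit is an integrated Bernoulli
divergence between log-odds s - βt and -αβt, which stays away from 0 because the two lines have
different slopes (`hardExponent_lt_softExponent`).

Both channels have additive noise (the soft one after conditioning on the permutation), so uniform
inputs are optimal and the capacity is log 2 minus the Shannon entropy rate, up to units. -/

namespace LRC

noncomputable section

/-! ### Bernoulli laws in log-odds coordinates -/

/-- The log-partition function `x ↦ log (1 + exp x)` of a Bernoulli variable with log-odds `x`. -/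
def softplus (x : ℝ) : ℝ := Real.log (1 + Real.exp x)

theorem one_add_exp_pos (x : ℝ) : 0 < 1 + Real.exp x := by positivity

theorem exp_softplus (x : ℝ) : Real.exp (softplus x) = 1 + Real.exp x :=
  Real.exp_log (one_add_exp_pos x)

@[fun_prop]
theorem continuous_softplus : Continuous softplus :=
  (continuous_const.add Real.continuous_exp).log fun x => (one_add_exp_pos x).ne'

@[fun_prop]
theorem continuous_real_sigmoid : Continuous Real.sigmoid := continuous_sigmoid

theorem softplus_nonneg (x : ℝ) : 0 ≤ softplus x :=
  Real.log_nonneg (by linarith [Real.exp_pos x])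

theorem le_softplus (x : ℝ) : x ≤ softplus x := by
  rw [← Real.exp_le_exp, exp_softplus]; linarith

theorem sigmoid_eq_exp (x : ℝ) : Real.sigmoid x = Real.exp (x - softplus x) := by
  rw [Real.exp_sub, exp_softplus, Real.sigmoid_def, Real.exp_neg]
  have := Real.exp_pos x
  field_simp
  ring

theorem one_sub_sigmoid_eq_exp (x : ℝ) : 1 - Real.sigmoid x = Real.exp (-softplus x) := by
  rw [sigmoid_eq_exp, Real.exp_sub, Real.exp_neg, exp_softplus]
  have := one_add_exp_pos x
  field_simp
  ring

theorem log_sigmoid (x : ℝ) : Real.log (Real.sigmoid x) = x - softplus x := by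
  rw [sigmoid_eq_exp, Real.log_exp]

theorem log_one_sub_sigmoid (x : ℝ) : Real.log (1 - Real.sigmoid x) = -softplus x := by
  rw [one_sub_sigmoid_eq_exp, Real.log_exp]

theorem binEntropy_sigmoid (x : ℝ) :
    Real.binEntropy (Real.sigmoid x) = softplus x - x * Real.sigmoid x := by
  rw [Real.binEntropy, Real.log_inv, Real.log_inv, log_sigmoid, log_one_sub_sigmoid]
  ring

theorem exists_sigmoid_eq {x : ℝ} (hx : x ∈ Set.Ioo (0 : ℝ) 1) : ∃ u, Real.sigmoid u = x := by
  rw [← Real.range_sigmoid] at hx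
  exact hx

/-- Divergence between Bernoulli laws with log-odds `u` and `v`, as a Bregman divergence, is
bounded below by the squared difference of their parameters. -/
theorem sq_sub_sigmoid_le (u v : ℝ) :
    (Real.sigmoid u - Real.sigmoid v) ^ 2 / 4
      ≤ softplus v - softplus u - Real.sigmoid u * (v - u) := by
  -- From log x ≤ x - 1 at x = √(p/r). Summed over both letters, it bounds the divergence below by
  -- the squared Hellinger distance.
  have key : ∀ r p : ℝ, 0 < r → 0 < p →
      r * (Real.log p - Real.log r) ≤ 2 * (√r * √p - r) := by
    intro r p hr hp
    have hr' := Real.sqrt_pos.2 hr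
    have hp' := Real.sqrt_pos.2 hp
    have h1 : Real.log p - Real.log r = 2 * Real.log (√p / √r) := by
      rw [Real.log_div hp'.ne' hr'.ne', Real.log_sqrt hp.le, Real.log_sqrt hr.le]; ring
    have h2 := Real.log_le_sub_one_of_pos (div_pos hp' hr')
    have h3 : r * (√p / √r) = √r * √p := by
      nth_rewrite 1 [← Real.mul_self_sqrt hr.le]
      field_simp
    rw [h1]
    nlinarith
  have hr := Real.sigmoid_pos u
  have hp := Real.sigmoid_pos v
  have hr1 : 0 < 1 - Real.sigmoid u := by linarith [Real.sigmoid_lt_one u]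
  have hp1 : 0 < 1 - Real.sigmoid v := by linarith [Real.sigmoid_lt_one v]
  have h1 := key _ _ hr hp
  have h2 := key _ _ hr1 hp1
  rw [log_sigmoid, log_sigmoid] at h1
  rw [log_one_sub_sigmoid, log_one_sub_sigmoid] at h2
  have e1 := Real.sq_sqrt hr.le
  have e2 := Real.sq_sqrt hp.le
  have e3 := Real.sq_sqrt hr1.le
  have e4 := Real.sq_sqrt hp1.le
  have n1 := Real.sqrt_nonneg (Real.sigmoid u)
  have n2 := Real.sqrt_nonneg (Real.sigmoid v)
  have l1 : √(Real.sigmoid u) ≤ 1 := Real.sqrt_le_one.2 (Real.sigmoid_le_one u)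
  have l2 : √(Real.sigmoid v) ≤ 1 := Real.sqrt_le_one.2 (Real.sigmoid_le_one v)
  have h3 : (Real.sigmoid u - Real.sigmoid v) ^ 2 / 4
      ≤ (√(Real.sigmoid u) - √(Real.sigmoid v)) ^ 2 := by
    have : Real.sigmoid u - Real.sigmoid v = (√(Real.sigmoid u) - √(Real.sigmoid v)) *
        (√(Real.sigmoid u) + √(Real.sigmoid v)) := by linear_combination e2 - e1
    rw [this, mul_pow]
    have : (√(Real.sigmoid u) + √(Real.sigmoid v)) ^ 2 ≤ 4 := by nlinarith
    nlinarith [sq_nonneg (√(Real.sigmoid u) - √(Real.sigmoid v))]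
  nlinarith [sq_nonneg (√(1 - Real.sigmoid u) - √(1 - Real.sigmoid v))]

/-- The gap is a Bernoulli divergence, hence nonnegative; equivalently, `softplus` is convex with
derivative `Real.sigmoid`. -/
theorem softplus_tangent (u v : ℝ) :
    softplus u + Real.sigmoid u * (v - u) ≤ softplus v := by
  have := sq_sub_sigmoid_le u v
  have := sq_nonneg (Real.sigmoid u - Real.sigmoid v)
  linarith

theorem abs_softplus_sub_le (u v : ℝ) : |softplus u - softplus v| ≤ |u - v| := by
  have h1 := softplus_tangent u v
  have h2 := softplus_tangent v u
  have hu := Real.sigmoid_pos u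
  have hu' := Real.sigmoid_lt_one u
  have hv := Real.sigmoid_pos v
  have hv' := Real.sigmoid_lt_one v
  rcases le_total u v with h | h
  · rw [abs_of_nonpos (by nlinarith), abs_of_nonpos (by linarith)]; nlinarith
  · rw [abs_of_nonneg (by nlinarith), abs_of_nonneg (by linarith)]; nlinarith

theorem abs_sigmoid_sub_le (u v : ℝ) : |Real.sigmoid u - Real.sigmoid v| ≤ |u - v| := by
  have h : LipschitzWith 1 Real.sigmoid := by
    refine lipschitzWith_of_nnnorm_deriv_le differentiable_sigmoid fun x => ?_
    rw [Real.deriv_sigmoid, ← NNReal.coe_le_coe, coe_nnnorm, Real.norm_eq_abs]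
    have h1 := Real.sigmoid_pos x
    have h2 := Real.sigmoid_lt_one x
    rw [abs_of_nonneg (by nlinarith)]
    push_cast
    nlinarith
  simpa [Real.dist_eq] using h.dist_le_mul u v

/-! ### Riemann sums -/

/-- Right-endpoint Riemann sums of a Lipschitz function on `[0, 1]`. -/
theorem abs_sum_sub_integral_le {f : ℝ → ℝ} {K : ℝ} (hf : Continuous f)
    (hK : ∀ x ∈ Set.Icc (0 : ℝ) 1, ∀ y ∈ Set.Icc (0 : ℝ) 1, |f x - f y| ≤ K * |x - y|)
    {n : ℕ} (hn : 0 < n) :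
    |∑ j : Fin n, f (((j : ℝ) + 1) / n) - n * ∫ t in (0 : ℝ)..1, f t| ≤ K := by
  have hn' : (0 : ℝ) < n := by exact_mod_cast hn
  have hK0 : 0 ≤ K := by
    have := hK 0 (by simp) 1 (by simp)
    simp at this
    exact (abs_nonneg _).trans this
  have hsplit : ∫ t in (0 : ℝ)..1, f t
      = ∑ j ∈ Finset.range n, ∫ t in ((j : ℝ) / n)..((j + 1 : ℕ) : ℝ) / n, f t := by
    have := intervalIntegral.sum_integral_adjacent_intervals
      (f := f) (μ := MeasureTheory.volume) (a := fun k : ℕ => (k : ℝ) / n) (n := n)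
      (fun k _ => hf.intervalIntegrable _ _)
    rw [this]
    simp [div_self hn'.ne']
  have hterm : ∀ j ∈ Finset.range n,
      |f (((j : ℝ) + 1) / n) - n * ∫ t in ((j : ℝ) / n)..((j + 1 : ℕ) : ℝ) / n, f t| ≤ K / n := by
    intro j hj
    have hj' : (j : ℝ) + 1 ≤ n := by exact_mod_cast Finset.mem_range.1 hj
    have hle : (j : ℝ) / n ≤ ((j : ℝ) + 1) / n := by gcongr; linarith
    have hlen : ((j : ℝ) + 1) / n - (j : ℝ) / n = 1 / n := by ring
    have h1 : ((j : ℝ) + 1) / n ≤ 1 := by rw [div_le_one hn']; exact hj'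
    have h0 : 0 ≤ (j : ℝ) / n := by positivity
    have heq : f (((j : ℝ) + 1) / n) - n * ∫ t in ((j : ℝ) / n)..((j + 1 : ℕ) : ℝ) / n, f t
        = n * ∫ t in ((j : ℝ) / n)..((j : ℝ) + 1) / n, (f (((j : ℝ) + 1) / n) - f t) := by
      rw [intervalIntegral.integral_sub (by simp) (hf.intervalIntegrable _ _),
        intervalIntegral.integral_const, hlen]
      push_cast
      rw [smul_eq_mul]
      field_simp
    have hb := intervalIntegral.norm_integral_le_of_norm_le_const
      (a := (j : ℝ) / n) (b := ((j : ℝ) + 1) / n) (C := K * (1 / n))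
      (f := fun t => f (((j : ℝ) + 1) / n) - f t) (by
        intro t ht
        rw [Set.uIoc_of_le hle] at ht
        refine (hK _ ⟨by linarith, h1⟩ t ⟨by linarith [ht.1], by linarith [ht.2]⟩).trans ?_
        gcongr
        rw [abs_of_nonneg (by linarith [ht.2])]
        linarith [ht.1])
    rw [heq, abs_mul, abs_of_pos hn']
    rw [hlen, abs_of_pos (by positivity), Real.norm_eq_abs] at hb
    calc (n : ℝ) * _ ≤ n * (K * (1 / n) * (1 / n)) := by gcongr
      _ = K / n := by field_simp
  rw [Fin.sum_univ_eq_sum_range (fun j => f (((j : ℝ) + 1) / n)) n, hsplit, Finset.mul_sum,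
    ← Finset.sum_sub_distrib]
  refine (Finset.abs_sum_le_sum_abs _ _).trans ((Finset.sum_le_sum hterm).trans ?_)
  rw [Finset.sum_const, Finset.card_range, nsmul_eq_mul]
  field_simp
  exact le_rfl

theorem tendsto_sum_div_integral {f : ℝ → ℝ} {K : ℝ} (hf : Continuous f)
    (hK : ∀ x ∈ Set.Icc (0 : ℝ) 1, ∀ y ∈ Set.Icc (0 : ℝ) 1, |f x - f y| ≤ K * |x - y|) :
    Tendsto (fun n : ℕ => (∑ j : Fin n, f (((j : ℝ) + 1) / n)) / n) atTop
      (𝓝 (∫ t in (0 : ℝ)..1, f t)) := by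
  rw [tendsto_iff_norm_sub_tendsto_zero]
  refine squeeze_zero' (.of_forall fun _ => norm_nonneg _) ?_
    (tendsto_const_div_atTop_nhds_zero_nat K)
  filter_upwards [eventually_gt_atTop 0] with n hn
  have hn' : (0 : ℝ) < n := by exact_mod_cast hn
  rw [Real.norm_eq_abs, le_div_iff₀ hn', ← abs_of_pos hn', ← abs_mul, abs_of_pos hn', sub_mul,
    div_mul_cancel₀ _ hn'.ne', mul_comm _ (n : ℝ)]
  exact abs_sum_sub_integral_le hf hK hn

/-! ### Limiting log-partition function, its conjugate, and the exponents -/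

/-- Limiting log-partition function of the noise weight when all log-odds are shifted by `s`. -/
def limitLogPartition (β s : ℝ) : ℝ := ∫ t in (0 : ℝ)..1, softplus (s - β * t)

/-- Limiting mean of the normalized noise weight when all log-odds are shifted by `s`. -/
def limitMean (β s : ℝ) : ℝ := ∫ t in (0 : ℝ)..1, Real.sigmoid (s - β * t)

/-- Legendre transform of `limitLogPartition`. -/
def limitConjugate (β θ : ℝ) : ℝ := ⨆ s : ℝ, (s * θ - limitLogPartition β s)

theorem integral_mono_unit {f g : ℝ → ℝ} (hf : Continuous f) (hg : Continuous g)
    (h : ∀ t ∈ Set.Icc (0 : ℝ) 1, f t ≤ g t) :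
    ∫ t in (0 : ℝ)..1, f t ≤ ∫ t in (0 : ℝ)..1, g t :=
  intervalIntegral.integral_mono_on zero_le_one (hf.intervalIntegrable _ _)
    (hg.intervalIntegrable _ _) h

theorem limitMean_le_sigmoid {β : ℝ} (hβ : 0 < β) (s : ℝ) : limitMean β s ≤ Real.sigmoid s := by
  have := integral_mono_unit (f := fun t => Real.sigmoid (s - β * t))
    (g := fun _ => Real.sigmoid s) (by fun_prop) (by fun_prop)
    (fun t ht => Real.sigmoid_le (by nlinarith [ht.1]))
  simpa [limitMean] using this

theorem sigmoid_le_limitMean {β : ℝ} (hβ : 0 < β) (s : ℝ) :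
    Real.sigmoid (s - β) ≤ limitMean β s := by
  have := integral_mono_unit (f := fun _ => Real.sigmoid (s - β))
    (g := fun t => Real.sigmoid (s - β * t)) (by fun_prop) (by fun_prop)
    (fun t ht => Real.sigmoid_le (by nlinarith [ht.2]))
  simpa [limitMean] using this

theorem limitMean_mem {β : ℝ} (hβ : 0 < β) (s : ℝ) : limitMean β s ∈ Set.Ioo (0 : ℝ) 1 :=
  ⟨(Real.sigmoid_pos _).trans_le (sigmoid_le_limitMean hβ s),
    (limitMean_le_sigmoid hβ s).trans_lt (Real.sigmoid_lt_one _)⟩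

/-- The sandwich σ(s-β) ≤ `limitMean β s` ≤ σ(s) and the intermediate value theorem show that every
interior density is the mean of some tilt. -/
theorem exists_limitMean_eq {β : ℝ} (hβ : 0 < β) {θ : ℝ} (hθ : θ ∈ Set.Ioo (0 : ℝ) 1) :
    ∃ s, limitMean β s = θ := by
  obtain ⟨u, rfl⟩ := exists_sigmoid_eq hθ
  have hc : Continuous (limitMean β) :=
    intervalIntegral.continuous_parametric_intervalIntegral_of_continuous' (by fun_prop) 0 1
  have h2 := sigmoid_le_limitMean hβ (u + β)
  rw [add_sub_cancel_right] at h2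
  obtain ⟨s, -, hs⟩ := intermediate_value_Icc (by linarith : u ≤ u + β) hc.continuousOn
    ⟨limitMean_le_sigmoid hβ u, h2⟩
  exact ⟨s, hs⟩

/-- `softplus` dominates both 0 and the identity, so xθ ≤ softplus x for θ in [0,1]. Boundedness
makes `limitConjugate` a genuine supremum rather than the default value of `iSup`. -/
theorem mul_sub_limitLogPartition_le {β : ℝ} (hβ : 0 < β) (s : ℝ)
    {θ : ℝ} (hθ : θ ∈ Set.Icc (0 : ℝ) 1) :
    s * θ - limitLogPartition β s ≤ β := by
  have := integral_mono_unit (f := fun _ => s * θ - β)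
    (g := fun t => softplus (s - β * t)) (by fun_prop) (by fun_prop) (by
      intro t ht
      have h1 := softplus_nonneg (s - β * t)
      have h2 := le_softplus (s - β * t)
      have h3 : (s - β * t) * θ ≤ softplus (s - β * t) := by
        rcases le_total 0 (s - β * t) with h | h
        · nlinarith [hθ.2]
        · nlinarith [hθ.1]
      nlinarith [hθ.1, hθ.2, ht.1, ht.2, mul_nonneg hβ.le ht.1, mul_nonneg ht.1 hθ.1,
        mul_le_one₀ ht.2 hθ.1 hθ.2])
  simp only [intervalIntegral.integral_const, sub_zero, one_smul] at this
  rw [limitLogPartition]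
  linarith

theorem bddAbove_conjugate {β : ℝ} (hβ : 0 < β) {θ : ℝ} (hθ : θ ∈ Set.Icc (0 : ℝ) 1) :
    BddAbove (Set.range fun s : ℝ => s * θ - limitLogPartition β s) := by
  refine ⟨β, ?_⟩
  rintro _ ⟨s, rfl⟩
  exact mul_sub_limitLogPartition_le hβ s hθ

theorem le_limitConjugate {β : ℝ} (hβ : 0 < β) (s : ℝ) {θ : ℝ} (hθ : θ ∈ Set.Icc (0 : ℝ) 1) :
    s * θ - limitLogPartition β s ≤ limitConjugate β θ :=
  le_ciSup (bddAbove_conjugate hβ hθ) s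

/-- A supremum of affine functions lies below its chord. -/
theorem limitConjugate_le {β : ℝ} (hβ : 0 < β) {θ : ℝ} (hθ : θ ∈ Set.Icc (0 : ℝ) 1) :
    limitConjugate β θ ≤ (1 - θ) * limitConjugate β 0 + θ * limitConjugate β 1 := by
  refine ciSup_le fun s => ?_
  have h0 := le_limitConjugate hβ s (θ := 0) (by simp)
  have h1 := le_limitConjugate hβ s (θ := 1) (by simp)
  nlinarith [hθ.1, hθ.2]

theorem neg_le_limitConjugate {β : ℝ} (hβ : 0 < β) {θ : ℝ} (hθ : θ ∈ Set.Icc (0 : ℝ) 1) :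
    -limitLogPartition β 0 ≤ limitConjugate β θ := by
  simpa using le_limitConjugate hβ 0 hθ

/-- Limiting exponent of the contribution of the words of normalized weight `θ` to the sum of the
`α`-th powers of the noise probabilities, up to a normalization independent of `θ`. -/
def limitExponent (β α θ : ℝ) : ℝ := (1 - α) * Real.binEntropy θ - α * limitConjugate β θ

/-- Limiting exponent of the sum of the `α`-th powers of the hard-decision noise probabilities,
up to normalization. -/
def hardExponent (β α : ℝ) : ℝ := sSup (limitExponent β α '' Set.Ioo 0 1)

theorem limitExponent_bdd {β α : ℝ} (hβ : 0 < β) (hα : 0 < α) :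
    BddAbove (limitExponent β α '' Set.Ioo 0 1) := by
  refine ⟨|1 - α| * Real.log 2 + α * limitLogPartition β 0, ?_⟩
  rintro _ ⟨θ, hθ, rfl⟩
  have h1 := neg_le_limitConjugate hβ (Set.Ioo_subset_Icc_self hθ)
  have h2 : Real.binEntropy θ ≤ Real.log 2 := Real.binEntropy_le_log_two
  have h3 := Real.binEntropy_nonneg hθ.1.le hθ.2.le
  have h4 : (1 - α) * Real.binEntropy θ ≤ |1 - α| * Real.log 2 := by
    have := le_abs_self (1 - α)
    have := abs_nonneg (1 - α)
    nlinarith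
  rw [limitExponent]
  nlinarith

/-- The endpoints, which are the weights 0 and n, are not covered by the supremum over the open
interval. Replacing the conjugate by its chord gives a continuous minorant `g` of the exponent that
agrees with it at 0 and 1, and the bound on `g` passes to the closure. -/
theorem limitExponent_le_hardExponent {β α : ℝ} (hβ : 0 < β) (hα : 0 < α)
    {θ : ℝ} (hθ : θ ∈ Set.Icc (0 : ℝ) 1) :
    limitExponent β α θ ≤ hardExponent β α := by
  have hin : ∀ θ ∈ Set.Ioo (0 : ℝ) 1, limitExponent β α θ ≤ hardExponent β α := fun θ hθ =>
    le_csSup (limitExponent_bdd hβ hα) ⟨θ, hθ, rfl⟩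
  set g : ℝ → ℝ := fun θ => (1 - α) * Real.binEntropy θ
    - α * ((1 - θ) * limitConjugate β 0 + θ * limitConjugate β 1) with hg
  have hgc : Continuous g := by fun_prop
  have hgle : ∀ θ ∈ Set.Icc (0 : ℝ) 1, g θ ≤ hardExponent β α := by
    have hsub : Set.Ioo (0 : ℝ) 1 ⊆ {θ | g θ ≤ hardExponent β α} := by
      intro θ hθ
      have := limitConjugate_le hβ (Set.Ioo_subset_Icc_self hθ)
      have := hin θ hθ
      rw [limitExponent] at this
      simp only [Set.mem_ofPred_eq, hg]
      nlinarith
    have := closure_minimal hsub (isClosed_le hgc continuous_const)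
    rwa [closure_Ioo zero_ne_one] at this
  rcases eq_or_lt_of_le hθ.1 with h | h
  · subst h
    simpa [hg, limitExponent] using hgle 0 (by simp)
  · rcases eq_or_lt_of_le hθ.2 with h' | h'
    · subst h'
      simpa [hg, limitExponent] using hgle 1 (by simp)
    · exact hin θ ⟨h, h'⟩

/-! ### Strict comparison of the exponents -/

/-- Strict Jensen: an injective `f` equals its mean at no more than one point, a null set, which
excludes the equality case. -/
theorem integral_binEntropy_lt {f : ℝ → ℝ} (hf : Continuous f) (hinj : Function.Injective f)
    (hmem : ∀ t, f t ∈ Set.Icc (0 : ℝ) 1) :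
    ∫ t in (0 : ℝ)..1, Real.binEntropy (f t) < Real.binEntropy (∫ t in (0 : ℝ)..1, f t) := by
  set μ := MeasureTheory.volume.restrict (Set.Ioc (0 : ℝ) 1) with hμ
  have : MeasureTheory.IsProbabilityMeasure μ := ⟨by simp [hμ]⟩
  have hint : ∀ g : ℝ → ℝ, Continuous g → MeasureTheory.Integrable g μ := fun g hg =>
    (intervalIntegrable_iff_integrableOn_Ioc_of_le zero_le_one).1 (hg.intervalIntegrable 0 1)
  have hc : Continuous Real.binEntropy := Real.binEntropy_continuous
  rcases Real.strictConcave_binEntropy.ae_eq_const_or_lt_map_average (μ := μ) (f := f)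
    hc.continuousOn isClosed_Icc (.of_forall hmem) (hint f hf)
    (hint _ (hc.comp hf)) with h | h
  · exfalso
    set c := ⨍ x, f x ∂μ
    have hnull : MeasureTheory.volume {t | f t = c} = 0 := by
      have hsub : {t | f t = c}.Subsingleton := fun x hx y hy => hinj (hx.trans hy.symm)
      exact hsub.measure_zero _
    have h2 : ∀ᵐ t ∂μ, f t ≠ c :=
      MeasureTheory.ae_restrict_of_ae (by simpa [MeasureTheory.ae_iff] using hnull)
    obtain ⟨t, ht, ht'⟩ := (h.and h2).exists
    exact ht' ht
  · rw [MeasureTheory.average_eq_integral, MeasureTheory.average_eq_integral] at h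
    rwa [intervalIntegral.integral_of_le zero_le_one, intervalIntegral.integral_of_le zero_le_one]

theorem integral_binEntropy_sigmoid_lt {k : ℝ} (hk : k ≠ 0) (s : ℝ) :
    ∫ t in (0 : ℝ)..1, Real.binEntropy (Real.sigmoid (s - k * t))
      < Real.binEntropy (∫ t in (0 : ℝ)..1, Real.sigmoid (s - k * t)) := by
  refine integral_binEntropy_lt (by fun_prop) ?_ fun t =>
    ⟨Real.sigmoid_nonneg _, Real.sigmoid_le_one _⟩
  intro x y hxy
  have := Real.sigmoid_injective hxy
  exact mul_left_cancel₀ hk (by linarith)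

/-- Limiting exponent of the sum of the `α`-th powers of the soft-decision noise probabilities,
up to normalization. -/
def softExponent (β α : ℝ) : ℝ := ∫ t in (0 : ℝ)..1, softplus (-(α * β) * t)

theorem softExponent_lt_hardExponent {β α : ℝ} (hβ : 0 < β) (hα : 0 < α) (hα1 : α < 1) :
    softExponent β α < hardExponent β α := by
  set k := α * β with hk
  have hk0 : 0 < k := by positivity
  -- The mean density of the law with log-odds -αβt, to which the α-th power of the soft noise law
  -- is proportional.
  set θ := ∫ t in (0 : ℝ)..1, Real.sigmoid (0 - k * t) with hθ
  have hθmem : θ ∈ Set.Icc (0 : ℝ) 1 := Set.Ioo_subset_Icc_self (limitMean_mem hk0 0)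
  refine lt_of_lt_of_le ?_ (limitExponent_le_hardExponent hβ hα hθmem)
  -- For each s, integrate the tangent inequality from -αβt to s - βt.
  have hJ : α * limitConjugate β θ ≤ ∫ t in (0 : ℝ)..1,
      (k * t * Real.sigmoid (0 - k * t) - α * Real.binEntropy (Real.sigmoid (0 - k * t))) := by
    rw [mul_comm, ← le_div_iff₀ hα]
    refine ciSup_le fun s => ?_
    rw [le_div_iff₀ hα, hθ, limitLogPartition, ← intervalIntegral.integral_const_mul,
      ← intervalIntegral.integral_sub
        (Continuous.intervalIntegrable (by fun_prop) _ _)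
        (Continuous.intervalIntegrable (by fun_prop) _ _), ← intervalIntegral.integral_mul_const]
    refine integral_mono_unit (by fun_prop) (by fun_prop) fun t _ => ?_
    have h1 := softplus_tangent (0 - k * t) (s - β * t)
    rw [binEntropy_sigmoid]
    have h2 := mul_le_mul_of_nonneg_left h1 hα.le
    have h3 : k * t = α * (β * t) := by rw [hk]; ring
    generalize Real.sigmoid (0 - k * t) = r at *
    generalize softplus (0 - k * t) = p at *
    rw [h3] at h2 ⊢
    nlinarith
  have hS := integral_binEntropy_sigmoid_lt hk0.ne' 0
  rw [limitExponent]
  -- The identity softplus u = h(σ(u)) + u σ(u) at u = -αβt, with the entropy split into weights 1-α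
  -- and α.
  have hsplit : softExponent β α = (1 - α) * (∫ t in (0 : ℝ)..1,
      Real.binEntropy (Real.sigmoid (0 - k * t))) - ∫ t in (0 : ℝ)..1,
      (k * t * Real.sigmoid (0 - k * t) - α * Real.binEntropy (Real.sigmoid (0 - k * t))) := by
    rw [← intervalIntegral.integral_const_mul, ← intervalIntegral.integral_sub
        (Continuous.intervalIntegrable (by fun_prop) _ _)
        (Continuous.intervalIntegrable (by fun_prop) _ _), softExponent]
    refine intervalIntegral.integral_congr fun t _ => ?_
    simp only [binEntropy_sigmoid, zero_sub, neg_mul]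
    ring
  rw [hsplit]
  have := mul_lt_mul_of_pos_left hS (by linarith : (0 : ℝ) < 1 - α)
  linarith

/-- Log-odds that differ by at least `δ`, one of them in a compact interval, give Bernoulli laws
with uniformly positive divergence. -/
theorem exists_pos_le_bregman (a b : ℝ) {δ : ℝ} (hδ : 0 < δ) :
    ∃ c > 0, ∀ v ∈ Set.Icc a b, ∀ u, δ ≤ |u - v| →
      c ≤ softplus v - softplus u - Real.sigmoid u * (v - u) := by
  have hex : ∀ g : ℝ → ℝ, Continuous g → (∀ v, 0 < g v) →
      ∃ c > 0, ∀ v ∈ Set.Icc a b, c ≤ g v := fun g hg hpos => by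
    obtain ⟨c, hc, h⟩ := isCompact_Icc.exists_forall_le' (s := Set.Icc a b) hg.continuousOn (a := 0)
      (fun v _ => hpos v)
    exact ⟨c, hc, h⟩
  -- Compactness gives a gap at distance exactly δ on each side; monotonicity of the sigmoid extends
  -- it to every u farther away.
  obtain ⟨c₁, hc₁, h₁⟩ := hex (fun v => Real.sigmoid (v + δ) - Real.sigmoid v) (by fun_prop)
    fun v => sub_pos.2 (Real.sigmoid_lt (by linarith))
  obtain ⟨c₂, hc₂, h₂⟩ := hex (fun v => Real.sigmoid v - Real.sigmoid (v - δ)) (by fun_prop)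
    fun v => sub_pos.2 (Real.sigmoid_lt (by linarith))
  refine ⟨(min c₁ c₂) ^ 2 / 4, by positivity, fun v hv u huv => ?_⟩
  refine le_trans ?_ (sq_sub_sigmoid_le u v)
  have h : min c₁ c₂ ≤ |Real.sigmoid u - Real.sigmoid v| := by
    rcases le_abs'.1 huv with h | h
    · have := Real.sigmoid_le (by linarith : u ≤ v - δ)
      have := h₂ v hv
      have := neg_abs_le (Real.sigmoid u - Real.sigmoid v)
      have := min_le_right c₁ c₂
      beta_reduce at *
      linarith
    · have := Real.sigmoid_le (by linarith : v + δ ≤ u)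
      have := h₁ v hv
      have := le_abs_self (Real.sigmoid u - Real.sigmoid v)
      have := min_le_left c₁ c₂
      beta_reduce at *
      linarith
  rw [← sq_abs (Real.sigmoid u - Real.sigmoid v)]
  have : 0 < min c₁ c₂ := lt_min hc₁ hc₂
  gcongr

theorem const_mul_le_integral {f : ℝ → ℝ} (hf : Continuous f) (h0 : ∀ t, 0 ≤ f t) {a b c : ℝ}
    (ha : 0 ≤ a) (hab : a ≤ b) (hb : b ≤ 1) (hc : ∀ t ∈ Set.Icc a b, c ≤ f t) :
    (b - a) * c ≤ ∫ t in (0 : ℝ)..1, f t := by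
  have h1 := intervalIntegral.integral_mono_on (μ := MeasureTheory.volume) hab
    (intervalIntegrable_const (c := c))
    (hf.intervalIntegrable a b) hc
  have h2 := intervalIntegral.integral_mono_interval ha hab hb
    (μ := MeasureTheory.volume) (.of_forall h0) (hf.intervalIntegrable 0 1)
  rw [intervalIntegral.integral_const, smul_eq_mul] at h1
  exact h1.trans h2

/-- Here 1-α < 0, so Jensen bounds each exponent above by `softExponent` minus an integrated Bregman
divergence. A gap for each θ would not suffice, since the supremum runs over an open interval; the
divergence is bounded below independently of θ. -/
theorem hardExponent_lt_softExponent {β α : ℝ} (hβ : 0 < β) (hα1 : 1 < α) :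
    hardExponent β α < softExponent β α := by
  have hα : 0 < α := by linarith
  -- The log-odds differ by s + (α-1)βt. According to the position of s relative to -(α-1)β/2, this
  -- is at least (α-1)β/4 in absolute value on all of [3/4,1] or on all of [0,1/4], an interval of
  -- length 1/4.
  obtain ⟨c, hc, hgap⟩ := exists_pos_le_bregman (-(α * β)) 0
    (by nlinarith : 0 < (α - 1) * β / 4)
  suffices h : hardExponent β α ≤ softExponent β α - c / 4 by linarith
  refine csSup_le ((Set.nonempty_Ioo.2 zero_lt_one).image _) ?_
  rintro _ ⟨θ, hθ, rfl⟩
  obtain ⟨s, hs⟩ := exists_limitMean_eq hβ hθ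
  have hJ := le_limitConjugate hβ s (Set.Ioo_subset_Icc_self hθ)
  have hh := (integral_binEntropy_sigmoid_lt hβ.ne' s).le
  rw [← limitMean, hs] at hh
  have hid : softExponent β α - ∫ t in (0 : ℝ)..1, (softplus (-(α * β) * t) - softplus (s - β * t)
        - Real.sigmoid (s - β * t) * (-(α * β) * t - (s - β * t)))
      = (1 - α) * (∫ t in (0 : ℝ)..1, Real.binEntropy (Real.sigmoid (s - β * t)))
        - α * (s * θ - limitLogPartition β s) := by
    rw [← hs, limitMean, limitLogPartition, softExponent]
    simp only [← intervalIntegral.integral_const_mul]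
    rw [← intervalIntegral.integral_sub
        (Continuous.intervalIntegrable (by fun_prop) _ _)
        (Continuous.intervalIntegrable (by fun_prop) _ _), ← intervalIntegral.integral_sub
        (Continuous.intervalIntegrable (by fun_prop) _ _)
        (Continuous.intervalIntegrable (by fun_prop) _ _), ← intervalIntegral.integral_const_mul,
        ← intervalIntegral.integral_sub
        (Continuous.intervalIntegrable (by fun_prop) _ _)
        (Continuous.intervalIntegrable (by fun_prop) _ _)]
    refine intervalIntegral.integral_congr fun t _ => ?_
    simp only [binEntropy_sigmoid]
    ring
  have hB : c / 4 ≤ ∫ t in (0 : ℝ)..1, (softplus (-(α * β) * t) - softplus (s - β * t)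
        - Real.sigmoid (s - β * t) * (-(α * β) * t - (s - β * t))) := by
    have h0 : ∀ t, 0 ≤ softplus (-(α * β) * t) - softplus (s - β * t)
        - Real.sigmoid (s - β * t) * (-(α * β) * t - (s - β * t)) := fun t => by
      linarith [softplus_tangent (s - β * t) (-(α * β) * t)]
    have hαβ : 0 < α * β := by positivity
    have hd : 0 < (α - 1) * β := by nlinarith
    rcases le_total (-((α - 1) * β) / 2) s with h | h
    · have := const_mul_le_integral (a := 3 / 4) (b := 1) (c := c) (by fun_prop) h0 (by norm_num)
        (by norm_num) le_rfl (fun t ht => hgap _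
          ⟨by nlinarith [ht.2], by nlinarith [ht.1]⟩ _ (by
            refine le_trans ?_ (le_abs_self _)
            nlinarith [ht.1]))
      linarith
    · have := const_mul_le_integral (a := 0) (b := 1 / 4) (c := c) (by fun_prop) h0 (by norm_num)
        (by norm_num) (by norm_num) (fun t ht => hgap _
          ⟨by nlinarith [ht.2], by nlinarith [ht.1]⟩ _ (by
            refine le_trans ?_ (neg_le_abs _)
            nlinarith [ht.2]))
      linarith
  rw [limitExponent]
  nlinarith

/-! ### Binary words with independent letters -/

/-- Probability of the word `e` when its letters are independent and letter `i` is `1` with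
log-odds `c i`. -/
def wordProb {n : ℕ} (c : Fin n → ℝ) (e : Fin n → ZMod 2) : ℝ :=
  ∏ i, if e i = 1 then Real.sigmoid (c i) else 1 - Real.sigmoid (c i)

/-- The letter `1` of the binary alphabet as a real number. -/
def bit (a : ZMod 2) : ℝ := if a = 1 then 1 else 0

/-- Number of letters `1` of a binary word. -/
def weight {n : ℕ} (e : Fin n → ZMod 2) : ℕ := (Finset.univ.filter fun i => e i = 1).card

theorem weight_eq_sum {n : ℕ} (e : Fin n → ZMod 2) : (weight e : ℝ) = ∑ i, bit (e i) := by
  simp [weight, bit]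

theorem weight_le {n : ℕ} (e : Fin n → ZMod 2) : weight e ≤ n := by
  simpa [weight] using Finset.card_filter_le (Finset.univ : Finset (Fin n)) fun i => e i = 1

theorem weight_mem_range {n : ℕ} (e : Fin n → ZMod 2) : weight e ∈ Finset.range (n + 1) :=
  Finset.mem_range.2 (Nat.lt_succ_of_le (weight_le e))

theorem sum_zmod_two (f : ZMod 2 → ℝ) : ∑ a, f a = f 0 + f 1 := Fin.sum_univ_two f

theorem wordProb_eq_exp {n : ℕ} (c : Fin n → ℝ) (e : Fin n → ZMod 2) :
    wordProb c e = Real.exp (∑ i, (bit (e i) * c i - softplus (c i))) := by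
  rw [wordProb, Real.exp_sum]
  refine Finset.prod_congr rfl fun i _ => ?_
  by_cases h : e i = 1
  · simp [h, bit, sigmoid_eq_exp]
  · simp [h, bit, one_sub_sigmoid_eq_exp]

theorem wordProb_pos {n : ℕ} (c : Fin n → ℝ) (e : Fin n → ZMod 2) : 0 < wordProb c e := by
  rw [wordProb_eq_exp]; exact Real.exp_pos _

/-- Independence: expectations of products over letters factor. Total mass, marginals and
covariances follow by choosing `g`. -/
theorem sum_wordProb_mul_prod {n : ℕ} (c : Fin n → ℝ) (g : Fin n → ZMod 2 → ℝ) :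
    ∑ e, wordProb c e * ∏ i, g i (e i)
      = ∏ i, (Real.sigmoid (c i) * g i 1 + (1 - Real.sigmoid (c i)) * g i 0) := by
  have := Fintype.prod_sum (fun (i : Fin n) (a : ZMod 2) =>
    (if a = 1 then Real.sigmoid (c i) else 1 - Real.sigmoid (c i)) * g i a)
  simp only [sum_zmod_two, zero_ne_one, if_false, if_true] at this
  simp only [wordProb, ← Finset.prod_mul_distrib]
  rw [← this]
  exact Finset.prod_congr rfl fun i _ => add_comm _ _

theorem sum_wordProb {n : ℕ} (c : Fin n → ℝ) : ∑ e, wordProb c e = 1 := by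
  simpa using sum_wordProb_mul_prod c fun _ _ => 1

theorem sum_wordProb_mul_apply {n : ℕ} (c : Fin n → ℝ) (i : Fin n) (g : ZMod 2 → ℝ) :
    ∑ e, wordProb c e * g (e i)
      = Real.sigmoid (c i) * g 1 + (1 - Real.sigmoid (c i)) * g 0 := by
  have := sum_wordProb_mul_prod c fun k a => if k = i then g a else 1
  simp only [Finset.prod_ite_eq', Finset.mem_univ, if_true] at this
  rw [this, Finset.prod_eq_single i]
  · simp
  · intro j _ hj
    simp [hj]
  · simp

theorem sum_wordProb_mul_centered {n : ℕ} (c : Fin n → ℝ) {i j : Fin n} (hij : i ≠ j) :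
    ∑ e, wordProb c e *
      ((bit (e i) - Real.sigmoid (c i)) * (bit (e j) - Real.sigmoid (c j))) = 0 := by
  have := sum_wordProb_mul_prod c fun k a =>
    (if k = i then bit a - Real.sigmoid (c k) else 1) *
      (if k = j then bit a - Real.sigmoid (c k) else 1)
  simp only [Finset.prod_mul_distrib, Finset.prod_ite_eq', Finset.mem_univ, if_true] at this
  rw [this]
  refine Finset.prod_eq_zero (Finset.mem_univ i) ?_
  simp only [if_true, if_neg hij, bit, zero_ne_one, if_false]
  ring

/-- Covariances of distinct letters vanish, and each letter has variance at most 1. -/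
theorem sum_wordProb_mul_sq_le {n : ℕ} (c : Fin n → ℝ) :
    ∑ e, wordProb c e * ((weight e : ℝ) - ∑ i, Real.sigmoid (c i)) ^ 2 ≤ n := by
  have hexp : ∀ e : Fin n → ZMod 2, wordProb c e * ((weight e : ℝ) - ∑ i, Real.sigmoid (c i)) ^ 2
      = ∑ i, ∑ j, wordProb c e *
        ((bit (e i) - Real.sigmoid (c i)) * (bit (e j) - Real.sigmoid (c j))) := fun e => by
    rw [weight_eq_sum, ← Finset.sum_sub_distrib, sq, Finset.sum_mul_sum, Finset.mul_sum]
    simp only [Finset.mul_sum]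
  simp only [hexp]
  rw [Finset.sum_comm]
  have hi : ∀ i : Fin n, ∑ e, ∑ j, wordProb c e *
      ((bit (e i) - Real.sigmoid (c i)) * (bit (e j) - Real.sigmoid (c j))) ≤ 1 := fun i => by
    rw [Finset.sum_comm, Finset.sum_eq_single i]
    · rw [← sum_wordProb c]
      refine Finset.sum_le_sum fun e _ => mul_le_of_le_one_right (wordProb_pos c e).le ?_
      have h1 := Real.sigmoid_pos (c i)
      have h2 := Real.sigmoid_lt_one (c i)
      unfold bit
      split_ifs <;> nlinarith
    · intro j _ hj
      exact sum_wordProb_mul_centered c hj.symm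
    · simp
  exact (Finset.sum_le_sum fun i _ => hi i).trans (by simp)

/-- Exponential tilting of a word distribution. -/
theorem wordProb_add_const {n : ℕ} (c : Fin n → ℝ) (s : ℝ) (e : Fin n → ZMod 2) :
    wordProb (fun i => c i + s) e = wordProb c e *
      Real.exp (s * weight e - ∑ i, (softplus (c i + s) - softplus (c i))) := by
  rw [wordProb_eq_exp, wordProb_eq_exp, ← Real.exp_add, weight_eq_sum, Finset.mul_sum,
    ← Finset.sum_sub_distrib, ← Finset.sum_add_distrib]
  congr 1
  refine Finset.sum_congr rfl fun i _ => ?_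
  ring

/-- A power of a product Bernoulli law is again one, with log-odds multiplied by α, up to a
constant. That constant is then the sum of the α-th powers. -/
theorem wordProb_rpow {n : ℕ} (c : Fin n → ℝ) (α : ℝ) (e : Fin n → ZMod 2) :
    wordProb c e ^ α = wordProb (fun i => α * c i) e *
      Real.exp (∑ i, (softplus (α * c i) - α * softplus (c i))) := by
  rw [wordProb_eq_exp, wordProb_eq_exp, ← Real.exp_mul, ← Real.exp_add, Finset.sum_mul,
    ← Finset.sum_add_distrib]
  congr 1
  refine Finset.sum_congr rfl fun i _ => ?_
  ring

theorem renyiEntropy_wordProb_of_ne {n : ℕ} (c : Fin n → ℝ) {α : ℝ} (hα : α ≠ 1) :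
    renyiEntropy α (wordProb c)
      = 1 / (1 - α) * ∑ i, (softplus (α * c i) - α * softplus (c i)) := by
  simp only [renyiEntropy, if_neg hα, wordProb_rpow, ← Finset.sum_mul, sum_wordProb, one_mul,
    Real.log_exp]

theorem renyiEntropy_wordProb_one {n : ℕ} (c : Fin n → ℝ) :
    renyiEntropy 1 (wordProb c) = ∑ i, Real.binEntropy (Real.sigmoid (c i)) := by
  have hlog : ∀ e, wordProb c e * Real.log (wordProb c e)
      = ∑ i, wordProb c e * (bit (e i) * c i - softplus (c i)) := fun e => by
    rw [← Finset.mul_sum]; congr 1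
    rw [wordProb_eq_exp, Real.log_exp]
  simp only [renyiEntropy, if_true, hlog]
  rw [Finset.sum_comm, ← Finset.sum_neg_distrib]
  refine Finset.sum_congr rfl fun i _ => ?_
  have := sum_wordProb_mul_apply c i fun a => bit a * c i - softplus (c i)
  rw [this, binEntropy_sigmoid]
  simp [bit]
  ring

/-! ### The law of the weight -/

/-- Probability that a word with independent letters has weight `w`. -/
def weightProb {n : ℕ} (c : Fin n → ℝ) (w : ℕ) : ℝ :=
  ∑ e ∈ Finset.univ.filter (fun e : Fin n → ZMod 2 => weight e = w), wordProb c e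

theorem sum_fiberwise_weight {n : ℕ} (F : (Fin n → ZMod 2) → ℝ) :
    ∑ e, F e = ∑ w ∈ Finset.range (n + 1),
      ∑ e ∈ Finset.univ.filter (fun e : Fin n → ZMod 2 => weight e = w), F e :=
  (Finset.sum_fiberwise_of_maps_to (fun e _ => weight_mem_range e) F).symm

theorem sum_weightProb_mul {n : ℕ} (c : Fin n → ℝ) (F : ℕ → ℝ) :
    ∑ w ∈ Finset.range (n + 1), weightProb c w * F w = ∑ e, wordProb c e * F (weight e) := by
  rw [sum_fiberwise_weight]
  refine Finset.sum_congr rfl fun w _ => ?_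
  rw [weightProb, Finset.sum_mul]
  refine Finset.sum_congr rfl fun e he => ?_
  rw [(Finset.mem_filter.1 he).2]

theorem sum_weightProb {n : ℕ} (c : Fin n → ℝ) :
    ∑ w ∈ Finset.range (n + 1), weightProb c w = 1 := by
  simpa [sum_wordProb] using sum_weightProb_mul c fun _ => 1

/-- The tilting factor depends on the word only through its weight. -/
theorem weightProb_add_const {n : ℕ} (c : Fin n → ℝ) (s : ℝ) (w : ℕ) :
    weightProb (fun i => c i + s) w = weightProb c w *
      Real.exp (s * w - ∑ i, (softplus (c i + s) - softplus (c i))) := by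
  rw [weightProb, weightProb, Finset.sum_mul]
  refine Finset.sum_congr rfl fun e he => ?_
  rw [wordProb_add_const, (Finset.mem_filter.1 he).2]

theorem card_weight_eq (n w : ℕ) :
    (Finset.univ.filter (fun e : Fin n → ZMod 2 => weight e = w)).card = n.choose w := by
  have h : (Finset.powersetCard w (Finset.univ : Finset (Fin n))).card = n.choose w := by simp
  rw [← h]
  refine Finset.card_nbij' (fun e => Finset.univ.filter fun i => e i = 1)
    (fun S i => if i ∈ S then 1 else 0) ?_ ?_ ?_ ?_
  · intro e he
    have : weight e = w := by simpa using he
    simpa [weight, Finset.mem_powersetCard] using this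
  · intro S hS
    have : S.card = w := by simpa [Finset.mem_powersetCard] using hS
    refine Finset.mem_coe.2 (Finset.mem_filter.2 ⟨Finset.mem_univ _, ?_⟩)
    simpa [weight] using this
  · intro e _
    have key : ∀ a : ZMod 2, (if a = 1 then (1 : ZMod 2) else 0) = a := by decide
    funext i
    simp [key]
  · intro S _
    ext i
    simp

theorem weightProb_pos {n : ℕ} (c : Fin n → ℝ) {w : ℕ} (hw : w ≤ n) : 0 < weightProb c w := by
  refine Finset.sum_pos (fun e _ => wordProb_pos c e) ?_
  rw [← Finset.card_pos, card_weight_eq]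
  exact Nat.choose_pos hw

theorem weightProb_le_one {n : ℕ} (c : Fin n → ℝ) (w : ℕ) : weightProb c w ≤ 1 := by
  rw [← sum_wordProb c]
  exact Finset.sum_le_sum_of_subset_of_nonneg (Finset.subset_univ _)
    fun e _ _ => (wordProb_pos c e).le

theorem exists_perm_of_weight_eq {n : ℕ} {e e' : Fin n → ZMod 2} (h : weight e = weight e') :
    ∃ σ : Equiv.Perm (Fin n), e' ∘ σ = e := by
  have hcard : Fintype.card {i // e i = 1} = Fintype.card {i // e' i = 1} := by
    rw [Fintype.card_subtype, Fintype.card_subtype]; exact h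
  let f := (Fintype.equivOfCardEq hcard).extendSubtype
  refine ⟨f, funext fun i => ?_⟩
  have key : ∀ a : ZMod 2, a ≠ 1 → a = 0 := by decide
  by_cases hi : e i = 1
  · exact ((Fintype.equivOfCardEq hcard).extendSubtype_mem i hi).trans hi.symm
  · exact (key _ ((Fintype.equivOfCardEq hcard).extendSubtype_not_mem i hi)).trans
      (key _ hi).symm

theorem weight_comp_perm {n : ℕ} (e : Fin n → ZMod 2) (σ : Equiv.Perm (Fin n)) :
    weight (e ∘ σ) = weight e := by
  have h : (weight (e ∘ σ) : ℝ) = weight e := by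
    rw [weight_eq_sum, weight_eq_sum]
    exact Equiv.sum_comp σ fun i => bit (e i)
  exact_mod_cast h

theorem wordProb_comp_perm {n : ℕ} (c : Fin n → ℝ) (e : Fin n → ZMod 2)
    (σ : Equiv.Perm (Fin n)) : wordProb (c ∘ σ) (e ∘ σ) = wordProb c e :=
  Equiv.prod_comp σ fun i => if e i = 1 then Real.sigmoid (c i) else 1 - Real.sigmoid (c i)

theorem weightProb_comp_perm {n : ℕ} (c : Fin n → ℝ) (w : ℕ) (σ : Equiv.Perm (Fin n)) :
    weightProb (c ∘ σ) w = weightProb c w := by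
  rw [weightProb, weightProb]
  refine Finset.sum_nbij' (fun e => e ∘ σ.symm) (fun e => e ∘ σ) ?_ ?_ ?_ ?_ ?_
  · intro e he
    simpa [weight_comp_perm] using he
  · intro e he
    simpa [weight_comp_perm] using he
  · intro e _
    funext i
    simp
  · intro e _
    funext i
    simp
  · intro e _
    have := wordProb_comp_perm c (e ∘ σ.symm) σ
    rw [← this]
    congr 1
    funext i
    simp

/-! ### Noise laws of the linear reliability channel -/

/-- Log-odds of a flip at the `j`-th least reliable position. -/
def logOdds (β : ℝ) (n : ℕ) (j : Fin n) : ℝ := -(β * (((j : ℝ) + 1) / n))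

theorem flipProb_eq_sigmoid (β : ℝ) (n : ℕ) (j : Fin n) :
    flipProb β n j = Real.sigmoid (logOdds β n j) := by
  have h : -β * ((j : ℝ) + 1) / n = logOdds β n j := by rw [logOdds]; ring
  rw [flipProb, h, sigmoid_eq_exp, Real.exp_sub, exp_softplus]

theorem softNoise_eq_wordProb (β : ℝ) (n : ℕ) (τ : Equiv.Perm (Fin n)) :
    softNoise β n τ = wordProb (logOdds β n ∘ τ) := by
  funext e
  simp [softNoise, wordProb, flipProb_eq_sigmoid]

theorem hardNoise_pos (β : ℝ) (n : ℕ) (e : Fin n → ZMod 2) : 0 < hardNoise β n e := by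
  simp only [hardNoise, softNoise_eq_wordProb]
  have : 0 < ∑ τ : Equiv.Perm (Fin n), wordProb (logOdds β n ∘ τ) e :=
    Finset.sum_pos (fun τ _ => wordProb_pos _ e) Finset.univ_nonempty
  positivity

theorem hardNoise_comp_perm (β : ℝ) (n : ℕ) (e : Fin n → ZMod 2) (σ : Equiv.Perm (Fin n)) :
    hardNoise β n (e ∘ σ) = hardNoise β n e := by
  simp only [hardNoise, softNoise_eq_wordProb]
  congr 1
  rw [← Equiv.sum_comp (Equiv.mulRight σ)]
  refine Finset.sum_congr rfl fun τ _ => ?_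
  exact wordProb_comp_perm (logOdds β n ∘ τ) e σ

theorem sum_hardNoise_weight_eq (β : ℝ) (n w : ℕ) :
    ∑ e ∈ Finset.univ.filter (fun e : Fin n → ZMod 2 => weight e = w), hardNoise β n e
      = weightProb (logOdds β n) w := by
  simp only [hardNoise, softNoise_eq_wordProb]
  rw [← Finset.mul_sum, Finset.sum_comm]
  have h : ∀ τ : Equiv.Perm (Fin n),
      ∑ e ∈ Finset.univ.filter (fun e : Fin n → ZMod 2 => weight e = w),
        wordProb (logOdds β n ∘ τ) e = weightProb (logOdds β n) w := fun τ =>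
    weightProb_comp_perm _ w τ
  simp only [h, Finset.sum_const, Finset.card_univ, Fintype.card_perm, Fintype.card_fin,
    nsmul_eq_mul]
  have := Nat.factorial_ne_zero n
  field_simp

/-- Permutations act transitively on each weight class, so the invariant law is constant there. The
mass of the class is the same for every τ. -/
theorem hardNoise_eq_div (β : ℝ) (n : ℕ) (e : Fin n → ZMod 2) :
    hardNoise β n e = weightProb (logOdds β n) (weight e) / n.choose (weight e) := by
  have hconst : ∀ e' ∈ Finset.univ.filter (fun e' : Fin n → ZMod 2 => weight e' = weight e),
      hardNoise β n e' = hardNoise β n e := fun e' he' => by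
    obtain ⟨σ, hσ⟩ := exists_perm_of_weight_eq (Finset.mem_filter.1 he').2
    rw [← hσ, hardNoise_comp_perm]
  have h := sum_hardNoise_weight_eq β n (weight e)
  rw [Finset.sum_congr rfl hconst, Finset.sum_const, card_weight_eq, nsmul_eq_mul] at h
  have : (n.choose (weight e) : ℝ) ≠ 0 := by
    exact_mod_cast (Nat.choose_pos (weight_le e)).ne'
  rw [← h]
  field_simp

theorem sum_comp_hardNoise (β : ℝ) (n : ℕ) (f : ℝ → ℝ) :
    ∑ e, f (hardNoise β n e) = ∑ w ∈ Finset.range (n + 1),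
      (n.choose w : ℝ) * f (weightProb (logOdds β n) w / n.choose w) := by
  rw [sum_fiberwise_weight]
  refine Finset.sum_congr rfl fun w _ => ?_
  rw [← card_weight_eq n w, ← nsmul_eq_mul, ← Finset.sum_const]
  refine Finset.sum_congr rfl fun e he => ?_
  rw [hardNoise_eq_div, (Finset.mem_filter.1 he).2, card_weight_eq]

/-! ### Entropy inequalities -/

/-- Gibbs' inequality. -/
theorem sum_mul_log_sub_le {ι : Type*} {S : Finset ι} {Q x : ι → ℝ} (hQ : ∀ i ∈ S, 0 < Q i)
    (hsum : ∑ i ∈ S, Q i = 1) (hx : ∀ i ∈ S, 0 < x i) :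
    ∑ i ∈ S, Q i * (Real.log (x i) - Real.log (Q i)) ≤ Real.log (∑ i ∈ S, x i) := by
  have := strictConcaveOn_log_Ioi.concaveOn.le_map_sum (t := S) (w := Q) (p := fun i => x i / Q i)
    (fun i hi => (hQ i hi).le) hsum (fun i hi => div_pos (hx i hi) (hQ i hi))
  simp only [smul_eq_mul] at this
  rw [Finset.sum_congr rfl fun i hi => mul_div_cancel₀ (x i) (hQ i hi).ne'] at this
  rwa [← Finset.sum_congr rfl fun i hi => congrArg (Q i * ·)
    (Real.log_div (hx i hi).ne' (hQ i hi).ne')]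

theorem sum_mul_log_nonpos {ι : Type*} {S : Finset ι} {Q : ι → ℝ} (hQ : ∀ i ∈ S, 0 < Q i)
    (hsum : ∑ i ∈ S, Q i = 1) : ∑ i ∈ S, Q i * Real.log (Q i) ≤ 0 :=
  Finset.sum_nonpos fun i hi => mul_nonpos_of_nonneg_of_nonpos (hQ i hi).le
    (Real.log_nonpos (hQ i hi).le
      (hsum ▸ Finset.single_le_sum (fun j hj => (hQ j hj).le) hi))

theorem neg_log_card_le_sum_mul_log {ι : Type*} {S : Finset ι} {Q : ι → ℝ}
    (hQ : ∀ i ∈ S, 0 < Q i) (hsum : ∑ i ∈ S, Q i = 1) :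
    -Real.log S.card ≤ ∑ i ∈ S, Q i * Real.log (Q i) := by
  have := sum_mul_log_sub_le (x := fun _ => 1) hQ hsum fun _ _ => one_pos
  simp at this
  linarith

/-! ### Binomial coefficients -/

theorem mul_log_sub_le_log_factorial (m : ℕ) : m * Real.log m - m ≤ Real.log m.factorial := by
  rcases Nat.eq_zero_or_pos m with rfl | hm
  · simp
  have hm' : (0 : ℝ) < m := by exact_mod_cast hm
  have hf : (0 : ℝ) < m.factorial := by exact_mod_cast m.factorial_pos
  have := Real.log_le_log (by positivity) (Real.pow_div_factorial_le_exp (m : ℝ) hm'.le m)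
  rw [Real.log_exp, Real.log_div (by positivity) hf.ne', Real.log_pow] at this
  linarith

theorem log_factorial_le (m : ℕ) :
    Real.log m.factorial ≤ m * Real.log m - m + Real.log (m + 1) + 1 := by
  rcases Nat.eq_zero_or_pos m with rfl | hm
  · simp
  -- This form is inductive for m ≥ 1, through log((k+1)/k) ≥ 1/(k+1); the final log(m+1) also
  -- covers m = 0.
  have h : Real.log m.factorial ≤ (m + 1) * Real.log m - m + 1 := by
    induction m, hm using Nat.le_induction with
    | base => simp
    | succ k hk ih =>
      have hk' : (0 : ℝ) < k := by exact_mod_cast hk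
      have h1 := Real.one_sub_inv_le_log_of_pos (x := ((k : ℝ) + 1) / k) (by positivity)
      rw [Real.log_div (by positivity) hk'.ne'] at h1
      have h2 : 1 - (((k : ℝ) + 1) / k)⁻¹ = 1 / (k + 1) := by field_simp; ring
      rw [h2, div_le_iff₀ (by positivity)] at h1
      rw [Nat.factorial_succ]
      push_cast
      rw [Real.log_mul (by positivity) (by exact_mod_cast k.factorial_ne_zero)]
      nlinarith
  have hm' : (0 : ℝ) < m := by exact_mod_cast hm
  have := Real.log_le_log hm' (by linarith : (m : ℝ) ≤ m + 1)
  linarith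

theorem mul_binEntropy_div {n w : ℕ} (hn : 0 < n) (hw : w ≤ n) :
    n * Real.binEntropy (w / n)
      = n * Real.log n - w * Real.log w - ((n - w : ℕ) : ℝ) * Real.log ((n - w : ℕ) : ℝ) := by
  have hn' : (0 : ℝ) < n := by exact_mod_cast hn
  have key : ∀ a : ℕ, n * ((a / n : ℝ) * Real.log (a / n : ℝ)⁻¹)
      = a * Real.log n - a * Real.log a := fun a => by
    rcases Nat.eq_zero_or_pos a with rfl | ha
    · simp
    have ha' : (0 : ℝ) < a := by exact_mod_cast ha
    rw [inv_div, Real.log_div hn'.ne' ha'.ne']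
    field_simp
  have h1 : 1 - (w : ℝ) / n = ((n - w : ℕ) : ℝ) / n := by
    rw [Nat.cast_sub hw]; field_simp
  rw [Real.binEntropy, h1, mul_add, key, key, Nat.cast_sub hw]
  ring

/-- The linear terms of the factorial estimates cancel because n = w + (n-w). The error is
logarithmic and uniform in w. -/
theorem abs_log_choose_sub_le {n w : ℕ} (hn : 0 < n) (hw : w ≤ n) :
    |Real.log (n.choose w) - n * Real.binEntropy (w / n)| ≤ 2 * Real.log (n + 1) + 2 := by
  have hc : Real.log (n.choose w) = Real.log n.factorial - Real.log w.factorial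
      - Real.log (n - w).factorial := by
    have h : (n.choose w : ℝ) * w.factorial * (n - w).factorial = n.factorial := by
      exact_mod_cast Nat.choose_mul_factorial_mul_factorial hw
    have h0 : (n.choose w : ℝ) ≠ 0 := by exact_mod_cast (Nat.choose_pos hw).ne'
    have h1 : (w.factorial : ℝ) ≠ 0 := by exact_mod_cast w.factorial_ne_zero
    have h2 : ((n - w).factorial : ℝ) ≠ 0 := by exact_mod_cast (n - w).factorial_ne_zero
    rw [← h, Real.log_mul (mul_ne_zero h0 h1) h2, Real.log_mul h0 h1]
    ring
  have hle : ∀ m : ℕ, m ≤ n → Real.log ((m : ℝ) + 1) ≤ Real.log (n + 1) := fun m hm =>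
    Real.log_le_log (by positivity) (by have : (m : ℝ) ≤ n := by exact_mod_cast hm
                                        linarith)
  have h0 : 0 ≤ Real.log ((n : ℝ) + 1) := by simpa using hle 0 (Nat.zero_le n)
  have a1 := mul_log_sub_le_log_factorial n
  have a2 := mul_log_sub_le_log_factorial w
  have a3 := mul_log_sub_le_log_factorial (n - w)
  have b1 := log_factorial_le n
  have b2 := log_factorial_le w
  have b3 := log_factorial_le (n - w)
  have c2 := hle w hw
  have c3 := hle (n - w) (Nat.sub_le n w)
  have hs : ((n - w : ℕ) : ℝ) = n - w := Nat.cast_sub hw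
  rw [mul_binEntropy_div hn hw, hc, abs_le]
  constructor <;> linarith

theorem tendsto_log_succ_div : Tendsto (fun n : ℕ => Real.log ((n : ℝ) + 1) / n) atTop (𝓝 0) := by
  have h1 : Tendsto (fun x : ℝ => Real.log x / x) atTop (𝓝 0) := by
    simpa using Real.isLittleO_log_id_atTop.tendsto_div_nhds_zero
  have h2 : Tendsto (fun n : ℕ => ((n + 1 : ℕ) : ℝ)) atTop atTop :=
    tendsto_natCast_atTop_atTop.comp (tendsto_add_atTop_nat 1)
  have h3 : Tendsto (fun n : ℕ => 2 * (Real.log ((n : ℝ) + 1) / ((n : ℝ) + 1))) atTop (𝓝 0) := by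
    simpa using (h1.comp h2).const_mul 2
  refine squeeze_zero' (.of_forall fun n => ?_) ?_ h3
  · exact div_nonneg (Real.log_nonneg (by linarith [Nat.cast_nonneg (α := ℝ) n])) n.cast_nonneg
  · filter_upwards [eventually_ge_atTop 1] with n hn
    have hn' : (1 : ℝ) ≤ n := by exact_mod_cast hn
    have hl : 0 ≤ Real.log ((n : ℝ) + 1) := Real.log_nonneg (by linarith)
    rw [← mul_div_assoc, div_le_div_iff₀ (by linarith) (by linarith)]
    nlinarith

theorem tendsto_const_mul_log_succ_add_div (a b : ℝ) :
    Tendsto (fun n : ℕ => (a * Real.log ((n : ℝ) + 1) + b) / n) atTop (𝓝 0) := by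
  have := (tendsto_log_succ_div.const_mul a).add (tendsto_const_div_atTop_nhds_zero_nat b)
  simp only [mul_zero, add_zero] at this
  refine this.congr fun n => ?_
  ring

/-! ### Concentration of the weight -/

/-- Log-odds of the positions of the channel, shifted by `s`. -/
def shiftedLogOdds (β s : ℝ) (n : ℕ) : Fin n → ℝ := fun j => logOdds β n j + s

theorem shiftedLogOdds_zero (β : ℝ) (n : ℕ) : shiftedLogOdds β 0 n = logOdds β n := by
  funext j
  simp [shiftedLogOdds]

theorem shiftedLogOdds_apply (β s : ℝ) (n : ℕ) (j : Fin n) :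
    shiftedLogOdds β s n j = s - β * (((j : ℝ) + 1) / n) := by
  rw [shiftedLogOdds, logOdds]; ring

theorem tendsto_mean (β s : ℝ) :
    Tendsto (fun n : ℕ => (∑ j, Real.sigmoid (shiftedLogOdds β s n j)) / n) atTop
      (𝓝 (limitMean β s)) := by
  simp only [shiftedLogOdds_apply]
  refine tendsto_sum_div_integral (f := fun t => Real.sigmoid (s - β * t)) (K := |β|)
    (by fun_prop) fun x _ y _ => ?_
  refine (abs_sigmoid_sub_le _ _).trans_eq ?_
  rw [← abs_mul, ← abs_neg]
  congr 1
  ring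

/-- The error is independent of s, which allows optimising over the tilt at fixed n in the Chernoff
bound. -/
theorem abs_sum_softplus_sub_le (β s : ℝ) {n : ℕ} (hn : 0 < n) :
    |∑ j, softplus (shiftedLogOdds β s n j) - n * limitLogPartition β s| ≤ |β| := by
  simp only [shiftedLogOdds_apply]
  refine abs_sum_sub_integral_le (f := fun t => softplus (s - β * t)) (K := |β|)
    (by fun_prop) (fun x _ y _ => ?_) hn
  refine (abs_softplus_sub_le _ _).trans_eq ?_
  rw [← abs_mul, ← abs_neg]
  congr 1
  ring

theorem sum_weightProb_mul_weight {n : ℕ} (c : Fin n → ℝ) :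
    ∑ w ∈ Finset.range (n + 1), weightProb c w * (w : ℝ) = ∑ i, Real.sigmoid (c i) := by
  rw [sum_weightProb_mul c fun w => (w : ℝ)]
  simp only [weight_eq_sum, Finset.mul_sum]
  rw [Finset.sum_comm]
  refine Finset.sum_congr rfl fun i _ => ?_
  rw [sum_wordProb_mul_apply c i bit]
  simp [bit]

/-- The mean square deviation is at most twice variance plus squared bias: the former is at most 1/n
after scaling, the latter tends to 0. -/
theorem tendsto_sum_weightProb_mul_sq (β s : ℝ) :
    Tendsto (fun n : ℕ => ∑ w ∈ Finset.range (n + 1),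
      weightProb (shiftedLogOdds β s n) w * ((w : ℝ) / n - limitMean β s) ^ 2) atTop (𝓝 0) := by
  have h1 : Tendsto (fun n : ℕ => 2 / (n : ℝ) + 2 * ((∑ j, Real.sigmoid (shiftedLogOdds β s n j)) / n
      - limitMean β s) ^ 2) atTop (𝓝 0) := by
    have := (tendsto_const_div_atTop_nhds_zero_nat (2 : ℝ)).add
      ((((tendsto_mean β s).sub_const (limitMean β s)).pow 2).const_mul 2)
    simpa using this
  refine squeeze_zero' (.of_forall fun n => ?_) ?_ h1
  · refine Finset.sum_nonneg fun w hw => mul_nonneg (weightProb_pos _ ?_).le (sq_nonneg _)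
    exact Nat.lt_succ_iff.1 (Finset.mem_range.1 hw)
  · filter_upwards [eventually_gt_atTop 0] with n hn
    have hn' : (0 : ℝ) < n := by exact_mod_cast hn
    set c := shiftedLogOdds β s n
    set m := ∑ j, Real.sigmoid (c j)
    have hvar := sum_wordProb_mul_sq_le c
    rw [← sum_weightProb_mul c fun w => ((w : ℝ) - m) ^ 2] at hvar
    calc ∑ w ∈ Finset.range (n + 1), weightProb c w * ((w : ℝ) / n - limitMean β s) ^ 2
        ≤ ∑ w ∈ Finset.range (n + 1), (2 / (n : ℝ) ^ 2 * (weightProb c w * ((w : ℝ) - m) ^ 2)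
          + 2 * (m / n - limitMean β s) ^ 2 * weightProb c w) := by
          refine Finset.sum_le_sum fun w hw => ?_
          have hp := (weightProb_pos c (Nat.lt_succ_iff.1 (Finset.mem_range.1 hw))).le
          have hsq : ((w : ℝ) / n - limitMean β s) ^ 2
              ≤ 2 / (n : ℝ) ^ 2 * ((w : ℝ) - m) ^ 2 + 2 * (m / n - limitMean β s) ^ 2 := by
            have e : 2 / (n : ℝ) ^ 2 * ((w : ℝ) - m) ^ 2 = 2 * ((w : ℝ) / n - m / n) ^ 2 := by
              field_simp
            rw [e]
            nlinarith [sq_nonneg ((w : ℝ) / n - m / n - (m / n - limitMean β s))]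
          nlinarith
      _ ≤ 2 / (n : ℝ) + 2 * (m / n - limitMean β s) ^ 2 := by
          rw [Finset.sum_add_distrib, ← Finset.mul_sum, ← Finset.mul_sum, sum_weightProb, mul_one]
          gcongr
          calc _ ≤ 2 / (n : ℝ) ^ 2 * (n : ℝ) := by gcongr
            _ = 2 / (n : ℝ) := by field_simp

/-- A pointwise form of Chebyshev's argument: continuity near θ, and away from it boundedness by log
2 against (x-θ)² ≥ δ². A second-moment bound then controls the expected entropy. -/
theorem exists_abs_binEntropy_sub_le {θ : ℝ} (hθ : θ ∈ Set.Icc (0 : ℝ) 1) {ε : ℝ} (hε : 0 < ε) :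
    ∃ K, 0 ≤ K ∧ ∀ x ∈ Set.Icc (0 : ℝ) 1,
      |Real.binEntropy x - Real.binEntropy θ| ≤ ε + K * (x - θ) ^ 2 := by
  obtain ⟨δ, hδ, h⟩ := Metric.continuous_iff.1 Real.binEntropy_continuous θ ε hε
  have hl := Real.log_nonneg one_le_two
  refine ⟨Real.log 2 / δ ^ 2, by positivity, fun x hx => ?_⟩
  by_cases hd : |x - θ| < δ
  · have := h x hd
    rw [Real.dist_eq] at this
    have : 0 ≤ Real.log 2 / δ ^ 2 * (x - θ) ^ 2 := by positivity
    linarith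
  · have h1 : δ ^ 2 ≤ (x - θ) ^ 2 := by
      rw [← sq_abs (x - θ)]; gcongr; exact not_lt.1 hd
    have h2 : Real.log 2 ≤ Real.log 2 / δ ^ 2 * (x - θ) ^ 2 := by
      rw [div_mul_eq_mul_div, le_div_iff₀ (by positivity)]; gcongr
    have h3 := Real.binEntropy_nonneg hx.1 hx.2
    have h4 := Real.binEntropy_nonneg hθ.1 hθ.2
    have h5 : Real.binEntropy x ≤ Real.log 2 := Real.binEntropy_le_log_two
    have h6 : Real.binEntropy θ ≤ Real.log 2 := Real.binEntropy_le_log_two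
    rw [abs_le]
    constructor <;> linarith

theorem tendsto_sum_weightProb_mul_binEntropy {β : ℝ} (hβ : 0 < β) (s : ℝ) :
    Tendsto (fun n : ℕ => ∑ w ∈ Finset.range (n + 1),
      weightProb (shiftedLogOdds β s n) w * Real.binEntropy ((w : ℝ) / n)) atTop
      (𝓝 (Real.binEntropy (limitMean β s))) := by
  rw [Metric.tendsto_atTop']
  intro ε hε
  obtain ⟨K, hK, h⟩ := exists_abs_binEntropy_sub_le
    (Set.Ioo_subset_Icc_self (limitMean_mem hβ s)) (half_pos hε)
  have hlim := (tendsto_sum_weightProb_mul_sq β s).const_mul K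
  rw [mul_zero] at hlim
  obtain ⟨N, hN⟩ := eventually_atTop.1 (hlim.eventually_lt_const (half_pos hε))
  refine ⟨N, fun n hn => ?_⟩
  have hn0 : (0 : ℝ) < n := by exact_mod_cast (Nat.zero_le N).trans_lt hn
  set c := shiftedLogOdds β s n
  have hsub : (∑ w ∈ Finset.range (n + 1), weightProb c w * Real.binEntropy ((w : ℝ) / n))
      - Real.binEntropy (limitMean β s) = ∑ w ∈ Finset.range (n + 1), weightProb c w *
        (Real.binEntropy ((w : ℝ) / n) - Real.binEntropy (limitMean β s)) := by
    simp only [mul_sub, Finset.sum_sub_distrib, ← Finset.sum_mul, sum_weightProb, one_mul]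
  rw [Real.dist_eq, hsub]
  calc _ ≤ ∑ w ∈ Finset.range (n + 1), (ε / 2 * weightProb c w
        + K * (weightProb c w * ((w : ℝ) / n - limitMean β s) ^ 2)) := by
        refine (Finset.abs_sum_le_sum_abs _ _).trans (Finset.sum_le_sum fun w hw => ?_)
        have hw' : w ≤ n := Nat.lt_succ_iff.1 (Finset.mem_range.1 hw)
        have hp := (weightProb_pos c hw').le
        rw [abs_mul, abs_of_nonneg hp]
        have := h ((w : ℝ) / n) ⟨by positivity, by
          rw [div_le_one hn0]; exact_mod_cast hw'⟩
        nlinarith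
    _ = ε / 2 + K * ∑ w ∈ Finset.range (n + 1),
        weightProb c w * ((w : ℝ) / n - limitMean β s) ^ 2 := by
        rw [Finset.sum_add_distrib, ← Finset.mul_sum, ← Finset.mul_sum, sum_weightProb, mul_one]
    _ < ε := by linarith [hN n hn.le]

theorem tendsto_sum_weightProb_mul_log_choose {β : ℝ} (hβ : 0 < β) (s : ℝ) :
    Tendsto (fun n : ℕ => (∑ w ∈ Finset.range (n + 1),
      weightProb (shiftedLogOdds β s n) w * Real.log (n.choose w)) / n) atTop
      (𝓝 (Real.binEntropy (limitMean β s))) := by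
  refine tendsto_of_tendsto_of_dist (tendsto_sum_weightProb_mul_binEntropy hβ s) ?_
  refine squeeze_zero' (.of_forall fun _ => dist_nonneg) ?_
    (tendsto_const_mul_log_succ_add_div 2 2)
  filter_upwards [eventually_gt_atTop 0] with n hn
  have hn' : (0 : ℝ) < n := by exact_mod_cast hn
  set c := shiftedLogOdds β s n
  rw [Real.dist_eq, le_div_iff₀ hn', ← abs_of_pos hn', ← abs_mul, abs_of_pos hn', sub_mul,
    div_mul_cancel₀ _ hn'.ne', Finset.sum_mul, ← Finset.sum_sub_distrib]
  refine (Finset.abs_sum_le_sum_abs _ _).trans ?_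
  calc _ ≤ ∑ w ∈ Finset.range (n + 1), weightProb c w * (2 * Real.log (n + 1) + 2) := by
        refine Finset.sum_le_sum fun w hw => ?_
        have hw' : w ≤ n := Nat.lt_succ_iff.1 (Finset.mem_range.1 hw)
        have hp := (weightProb_pos c hw').le
        have := abs_log_choose_sub_le hn hw'
        rw [abs_sub_comm] at this
        rw [mul_assoc, ← mul_sub, abs_mul, abs_of_nonneg hp, mul_comm (Real.binEntropy _)]
        gcongr
    _ = _ := by rw [← Finset.sum_mul, sum_weightProb, one_mul]

/-! ### Entropy rate of the hard-decision noise -/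

theorem log_weightProb_shifted (β s : ℝ) {n w : ℕ} (hw : w ≤ n) :
    Real.log (weightProb (logOdds β n) w) = Real.log (weightProb (shiftedLogOdds β s n) w)
      - s * w + (∑ j, softplus (shiftedLogOdds β s n j)
        - ∑ j, softplus (shiftedLogOdds β 0 n j)) := by
  have h : weightProb (shiftedLogOdds β s n) w = _ := weightProb_add_const (logOdds β n) s w
  rw [h, Real.log_mul (weightProb_pos _ hw).ne' (Real.exp_ne_zero _), Real.log_exp,
    shiftedLogOdds_zero, Finset.sum_sub_distrib]
  simp only [shiftedLogOdds]
  ring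

/-- Chernoff bound: the tilted probability is at most 1 for every s. The error 2β comes from two
Riemann sums. -/
theorem log_weightProb_le {β : ℝ} (hβ : 0 < β) {n w : ℕ} (hn : 0 < n) (hw : w ≤ n) :
    Real.log (weightProb (logOdds β n) w)
      ≤ -(n * (limitConjugate β (w / n) + limitLogPartition β 0)) + 2 * β := by
  have hn' : (0 : ℝ) < n := by exact_mod_cast hn
  -- Solved for the conjugate, so that the optimisation over s becomes a bound on a supremum.
  have h : limitConjugate β (w / n) ≤ (2 * β - Real.log (weightProb (logOdds β n) w)) / n
      - limitLogPartition β 0 := by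
    refine ciSup_le fun s => ?_
    have h1 := log_weightProb_shifted β s hw
    have h2 := Real.log_nonpos (weightProb_pos (shiftedLogOdds β s n) hw).le
      (weightProb_le_one _ w)
    have h3 := (abs_le.1 (abs_sum_softplus_sub_le β s hn)).2
    have h4 := (abs_le.1 (abs_sum_softplus_sub_le β 0 hn)).1
    rw [abs_of_pos hβ] at h3 h4
    rw [le_sub_iff_add_le, le_div_iff₀ hn']
    have : (s * (w / n) - limitLogPartition β s + limitLogPartition β 0) * n
        = s * w - n * limitLogPartition β s + n * limitLogPartition β 0 := by
      field_simp
    rw [this]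
    linarith
  rw [le_sub_iff_add_le, le_div_iff₀ hn'] at h
  linarith

/-- Contribution of the words of weight `w` to the sum of the `α`-th powers of the hard-decision
noise probabilities. -/
def hardTerm (β α : ℝ) (n w : ℕ) : ℝ :=
  (n.choose w : ℝ) * (weightProb (logOdds β n) w / n.choose w) ^ α

theorem choose_cast_pos {n w : ℕ} (hw : w ≤ n) : (0 : ℝ) < n.choose w := by
  exact_mod_cast Nat.choose_pos hw

theorem hardTerm_pos (β α : ℝ) {n w : ℕ} (hw : w ≤ n) : 0 < hardTerm β α n w :=
  mul_pos (choose_cast_pos hw)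
    (Real.rpow_pos_of_pos (div_pos (weightProb_pos _ hw) (choose_cast_pos hw)) _)

theorem log_hardTerm (β α : ℝ) {n w : ℕ} (hw : w ≤ n) :
    Real.log (hardTerm β α n w) = (1 - α) * Real.log (n.choose w)
      + α * Real.log (weightProb (logOdds β n) w) := by
  have h1 := choose_cast_pos hw
  have h2 := weightProb_pos (logOdds β n) hw
  rw [hardTerm, Real.log_mul h1.ne' (Real.rpow_pos_of_pos (div_pos h2 h1) _).ne',
    Real.log_rpow (div_pos h2 h1), Real.log_div h2.ne' h1.ne']
  ring

theorem log_hardTerm_le {β α : ℝ} (hβ : 0 < β) (hα : 0 < α) {n w : ℕ} (hn : 0 < n)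
    (hw : w ≤ n) :
    Real.log (hardTerm β α n w) ≤ n * (hardExponent β α - α * limitLogPartition β 0)
      + |1 - α| * (2 * Real.log (n + 1) + 2) + 2 * α * β := by
  have hn' : (0 : ℝ) < n := by exact_mod_cast hn
  have h1 := mul_le_mul_of_nonneg_left (log_weightProb_le hβ hn hw) hα.le
  have h2 := mul_le_mul_of_nonneg_left (abs_log_choose_sub_le hn hw) (abs_nonneg (1 - α))
  rw [← abs_mul] at h2
  have h3 := (le_abs_self _).trans h2
  have h4 := mul_le_mul_of_nonneg_left (limitExponent_le_hardExponent hβ hα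
    (θ := (w : ℝ) / n) ⟨by positivity, by rw [div_le_one hn']; exact_mod_cast hw⟩) hn'.le
  rw [limitExponent] at h4
  rw [log_hardTerm β α hw]
  linarith

/-- There are only n+1 weights, so summing costs log(n+1) beyond the largest term. -/
theorem log_sum_hardTerm_le {β α : ℝ} (hβ : 0 < β) (hα : 0 < α) {n : ℕ} (hn : 0 < n) :
    Real.log (∑ w ∈ Finset.range (n + 1), hardTerm β α n w)
      ≤ n * (hardExponent β α - α * limitLogPartition β 0)
      + ((2 * |1 - α| + 1) * Real.log (n + 1) + (2 * |1 - α| + 2 * α * β)) := by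
  set B := n * (hardExponent β α - α * limitLogPartition β 0)
      + |1 - α| * (2 * Real.log (n + 1) + 2) + 2 * α * β with hB
  have hle : ∀ w ∈ Finset.range (n + 1), hardTerm β α n w ≤ Real.exp B := fun w hw => by
    have hw' : w ≤ n := Nat.lt_succ_iff.1 (Finset.mem_range.1 hw)
    rw [← Real.log_le_iff_le_exp (hardTerm_pos β α hw')]
    exact log_hardTerm_le hβ hα hn hw'
  have hpos : 0 < ∑ w ∈ Finset.range (n + 1), hardTerm β α n w :=
    Finset.sum_pos (fun w hw => hardTerm_pos β α (Nat.lt_succ_iff.1 (Finset.mem_range.1 hw)))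
      (by simp)
  have h := Real.log_le_log hpos (Finset.sum_le_sum hle)
  rw [Finset.sum_const, Finset.card_range, nsmul_eq_mul,
    Real.log_mul (by positivity) (Real.exp_ne_zero _), Real.log_exp] at h
  push_cast at h
  linarith

/-- Gibbs' inequality with the tilted weight law as trial distribution, whose entropy contributes at
most |1-α| log(n+1). -/
theorem le_log_sum_hardTerm (β α s : ℝ) (n : ℕ) :
    (1 - α) * ∑ w ∈ Finset.range (n + 1),
        weightProb (shiftedLogOdds β s n) w * Real.log (n.choose w)
      - |1 - α| * Real.log (n + 1)
      + α * ((∑ j, softplus (shiftedLogOdds β s n j) - ∑ j, softplus (shiftedLogOdds β 0 n j))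
        - s * ∑ j, Real.sigmoid (shiftedLogOdds β s n j))
      ≤ Real.log (∑ w ∈ Finset.range (n + 1), hardTerm β α n w) := by
  set Q := weightProb (shiftedLogOdds β s n) with hQdef
  set D := ∑ j, softplus (shiftedLogOdds β s n j) - ∑ j, softplus (shiftedLogOdds β 0 n j)
  have hQ : ∀ w ∈ Finset.range (n + 1), 0 < Q w := fun w hw =>
    weightProb_pos _ (Nat.lt_succ_iff.1 (Finset.mem_range.1 hw))
  have hsum : ∑ w ∈ Finset.range (n + 1), Q w = 1 := sum_weightProb _
  have hG := sum_mul_log_sub_le hQ hsum (x := hardTerm β α n) fun w hw =>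
    hardTerm_pos β α (Nat.lt_succ_iff.1 (Finset.mem_range.1 hw))
  refine le_trans ?_ hG
  have e : ∑ w ∈ Finset.range (n + 1), Q w * (Real.log (hardTerm β α n w) - Real.log (Q w))
      = (1 - α) * ∑ w ∈ Finset.range (n + 1), Q w * Real.log (n.choose w)
        - (1 - α) * ∑ w ∈ Finset.range (n + 1), Q w * Real.log (Q w)
        + α * (D * ∑ w ∈ Finset.range (n + 1), Q w
        - s * ∑ w ∈ Finset.range (n + 1), Q w * (w : ℝ)) := by
    simp only [Finset.mul_sum, ← Finset.sum_sub_distrib, ← Finset.sum_add_distrib]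
    refine Finset.sum_congr rfl fun w hw => ?_
    have hw' : w ≤ n := Nat.lt_succ_iff.1 (Finset.mem_range.1 hw)
    rw [log_hardTerm β α hw', log_weightProb_shifted β s hw']
    ring
  rw [e, hsum, hQdef, sum_weightProb_mul_weight, ← hQdef, mul_one]
  have h1 := sum_mul_log_nonpos hQ hsum
  have h2 := neg_log_card_le_sum_mul_log hQ hsum
  rw [Finset.card_range] at h2
  push_cast at h2
  have h3 : (1 - α) * ∑ w ∈ Finset.range (n + 1), Q w * Real.log (Q w)
      ≤ |1 - α| * Real.log (n + 1) := by
    refine (le_abs_self _).trans ?_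
    rw [abs_mul, abs_of_nonpos h1]
    exact mul_le_mul_of_nonneg_left (by linarith) (abs_nonneg _)
  linarith

theorem tendsto_sum_softplus_div (β s : ℝ) :
    Tendsto (fun n : ℕ => (∑ j, softplus (shiftedLogOdds β s n j)) / n) atTop
      (𝓝 (limitLogPartition β s)) := by
  simp only [shiftedLogOdds_apply]
  refine tendsto_sum_div_integral (f := fun t => softplus (s - β * t)) (K := |β|)
    (by fun_prop) fun x _ y _ => ?_
  refine (abs_softplus_sub_le _ _).trans_eq ?_
  rw [← abs_mul, ← abs_neg]
  congr 1
  ring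

theorem tendsto_log_sum_hardTerm {β α : ℝ} (hβ : 0 < β) (hα : 0 < α) :
    Tendsto (fun n : ℕ => Real.log (∑ w ∈ Finset.range (n + 1), hardTerm β α n w) / n) atTop
      (𝓝 (hardExponent β α - α * limitLogPartition β 0)) := by
  refine tendsto_order.2 ⟨fun a ha => ?_, fun b hb => ?_⟩
  · obtain ⟨_, ⟨θ, hθ, rfl⟩, hlt⟩ := exists_lt_of_lt_csSup
      ((Set.nonempty_Ioo.2 zero_lt_one).image (limitExponent β α))
      (show a + α * limitLogPartition β 0 < hardExponent β α by linarith)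
    obtain ⟨s, rfl⟩ := exists_limitMean_eq hβ hθ
    -- Only this inequality is needed, not optimality of s: it makes the exponent reached by this
    -- tilt at least `limitExponent` at its mean.
    have hJ := le_limitConjugate hβ s (Set.Ioo_subset_Icc_self hθ)
    have hlim := (((tendsto_sum_weightProb_mul_log_choose hβ s).const_mul (1 - α)).sub
      (tendsto_log_succ_div.const_mul |1 - α|)).add
      ((((tendsto_sum_softplus_div β s).sub (tendsto_sum_softplus_div β 0)).sub
        ((tendsto_mean β s).const_mul s)).const_mul α)
    have hlt' : a < (1 - α) * Real.binEntropy (limitMean β s) - |1 - α| * 0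
        + α * (limitLogPartition β s - limitLogPartition β 0 - s * limitMean β s) := by
      have := mul_le_mul_of_nonneg_left hJ hα.le
      rw [limitExponent] at hlt
      linarith
    filter_upwards [hlim.eventually_const_lt hlt', eventually_gt_atTop 0] with n hn hn0
    have hn' : (0 : ℝ) < n := by exact_mod_cast hn0
    refine hn.trans_le ?_
    rw [le_div_iff₀ hn']
    refine le_trans (le_of_eq ?_) (le_log_sum_hardTerm β α s n)
    field_simp
  · have hlim := (tendsto_const_mul_log_succ_add_div (2 * |1 - α| + 1)
      (2 * |1 - α| + 2 * α * β)).const_add (hardExponent β α - α * limitLogPartition β 0)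
    rw [add_zero] at hlim
    filter_upwards [hlim.eventually_lt_const hb, eventually_gt_atTop 0] with n hn hn0
    have hn' : (0 : ℝ) < n := by exact_mod_cast hn0
    refine lt_of_le_of_lt ?_ hn
    rw [div_le_iff₀ hn']
    refine (log_sum_hardTerm_le hβ hα hn0).trans (le_of_eq ?_)
    field_simp

/-! ### Entropy rates and their comparison -/

/-- Entropy rate of the soft-decision noise. -/
def softRate (β α : ℝ) : ℝ :=
  if α = 1 then ∫ t in (0 : ℝ)..1, Real.binEntropy (Real.sigmoid (0 - β * t))
  else 1 / (1 - α) * (softExponent β α - α * limitLogPartition β 0)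

/-- Entropy rate of the hard-decision noise. -/
def hardRate (β α : ℝ) : ℝ :=
  if α = 1 then Real.binEntropy (limitMean β 0)
  else 1 / (1 - α) * (hardExponent β α - α * limitLogPartition β 0)

theorem renyiEntropy_softNoise_one (β : ℝ) (n : ℕ) (τ : Equiv.Perm (Fin n)) :
    renyiEntropy 1 (softNoise β n τ)
      = ∑ j, Real.binEntropy (Real.sigmoid (logOdds β n j)) := by
  rw [softNoise_eq_wordProb, renyiEntropy_wordProb_one]
  exact Equiv.sum_comp τ fun j => Real.binEntropy (Real.sigmoid (logOdds β n j))

theorem renyiEntropy_softNoise_of_ne (β : ℝ) (n : ℕ) (τ : Equiv.Perm (Fin n)) {α : ℝ}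
    (hα : α ≠ 1) :
    renyiEntropy α (softNoise β n τ) = 1 / (1 - α) *
      (∑ j, softplus (α * logOdds β n j) - α * ∑ j, softplus (logOdds β n j)) := by
  rw [softNoise_eq_wordProb, renyiEntropy_wordProb_of_ne _ hα]
  congr 1
  rw [Finset.mul_sum, ← Finset.sum_sub_distrib]
  exact Equiv.sum_comp τ fun j => softplus (α * logOdds β n j) - α * softplus (logOdds β n j)

/-- In log-odds the entropy is softplus x - x σ(x), which is Lipschitz on bounded sets; this yields
an explicit constant. -/
theorem tendsto_sum_binEntropy_div (β : ℝ) :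
    Tendsto (fun n : ℕ => (∑ j, Real.binEntropy (Real.sigmoid (logOdds β n j))) / n) atTop
      (𝓝 (∫ t in (0 : ℝ)..1, Real.binEntropy (Real.sigmoid (0 - β * t)))) := by
  have e : ∀ (n : ℕ) (j : Fin n), logOdds β n j = 0 - β * (((j : ℝ) + 1) / n) := fun n j => by
    rw [logOdds, zero_sub]
  simp only [e]
  refine tendsto_sum_div_integral (f := fun t => Real.binEntropy (Real.sigmoid (0 - β * t)))
    (K := 2 * |β| + |β| * |β|) (by fun_prop) fun x hx y hy => ?_
  set u := 0 - β * x with hu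
  set v := 0 - β * y with hv
  have huv : |u - v| = |β| * |x - y| := by
    rw [← abs_mul, ← abs_neg]; congr 1; rw [hu, hv]; ring
  have hv1 : |v| ≤ |β| := by
    rw [hv, zero_sub, abs_neg, abs_mul, abs_of_nonneg hy.1]
    exact mul_le_of_le_one_right (abs_nonneg _) hy.2
  have h1 := abs_softplus_sub_le u v
  have h2 := abs_sigmoid_sub_le u v
  rw [binEntropy_sigmoid, binEntropy_sigmoid]
  have hd : softplus u - u * Real.sigmoid u - (softplus v - v * Real.sigmoid v)
      = (softplus u - softplus v) - (u - v) * Real.sigmoid u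
        - v * (Real.sigmoid u - Real.sigmoid v) := by ring
  have h3 : |(u - v) * Real.sigmoid u| ≤ |u - v| := by
    rw [abs_mul, abs_of_pos (Real.sigmoid_pos u)]
    exact mul_le_of_le_one_right (abs_nonneg _) (Real.sigmoid_le_one u)
  have h4 : |v * (Real.sigmoid u - Real.sigmoid v)| ≤ |β| * |u - v| := by
    rw [abs_mul]; gcongr
  calc _ ≤ |u - v| + |u - v| + |β| * |u - v| := by
        rw [hd]
        refine (abs_sub _ _).trans (add_le_add ((abs_sub _ _).trans (add_le_add h1 h3)) h4)
    _ = _ := by rw [huv]; ring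

theorem hasRenyiEntropyRate_softNoise (β α : ℝ) (τ : (n : ℕ) → Equiv.Perm (Fin n)) :
    HasRenyiEntropyRate (fun n => softNoise β n (τ n)) α (softRate β α) := by
  unfold HasRenyiEntropyRate softRate
  split_ifs with h
  · subst h
    simp only [renyiEntropy_softNoise_one]
    exact tendsto_sum_binEntropy_div β
  · simp only [renyiEntropy_softNoise_of_ne _ _ _ h]
    have h1 : Tendsto (fun n : ℕ => (∑ j, softplus (α * logOdds β n j)) / n) atTop
        (𝓝 (softExponent β α)) := by
      have e : ∀ (n : ℕ) (j : Fin n),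
          α * logOdds β n j = -(α * β) * (((j : ℝ) + 1) / n) := fun n j => by
        rw [logOdds]; ring
      simp only [e]
      refine tendsto_sum_div_integral (f := fun t => softplus (-(α * β) * t)) (K := |α * β|)
        (by fun_prop) fun x _ y _ => (abs_softplus_sub_le _ _).trans_eq ?_
      rw [← mul_sub, abs_mul, abs_neg]
    have h2 := tendsto_sum_softplus_div β 0
    simp only [shiftedLogOdds_zero] at h2
    refine ((h1.sub (h2.const_mul α)).const_mul (1 / (1 - α))).congr fun n => ?_
    ring

theorem renyiEntropy_hardNoise_of_ne (β : ℝ) (n : ℕ) {α : ℝ} (hα : α ≠ 1) :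
    renyiEntropy α (hardNoise β n)
      = 1 / (1 - α) * Real.log (∑ w ∈ Finset.range (n + 1), hardTerm β α n w) := by
  rw [renyiEntropy, if_neg hα, sum_comp_hardNoise β n fun x => x ^ α]
  rfl

theorem renyiEntropy_hardNoise_one (β : ℝ) (n : ℕ) :
    renyiEntropy 1 (hardNoise β n)
      = ∑ w ∈ Finset.range (n + 1), weightProb (logOdds β n) w * Real.log (n.choose w)
        - ∑ w ∈ Finset.range (n + 1),
          weightProb (logOdds β n) w * Real.log (weightProb (logOdds β n) w) := by
  rw [renyiEntropy, if_pos rfl, sum_comp_hardNoise β n fun x => x * Real.log x,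
    ← Finset.sum_sub_distrib, ← Finset.sum_neg_distrib]
  refine Finset.sum_congr rfl fun w hw => ?_
  have hw' : w ≤ n := Nat.lt_succ_iff.1 (Finset.mem_range.1 hw)
  have h1 := choose_cast_pos hw'
  have h2 := weightProb_pos (logOdds β n) hw'
  rw [Real.log_div h2.ne' h1.ne']
  field_simp
  ring

theorem hasRenyiEntropyRate_hardNoise {β α : ℝ} (hβ : 0 < β) (hα : 0 < α) :
    HasRenyiEntropyRate (fun n => hardNoise β n) α (hardRate β α) := by
  unfold HasRenyiEntropyRate hardRate
  split_ifs with h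
  · subst h
    simp only [renyiEntropy_hardNoise_one, sub_div]
    have h1 := tendsto_sum_weightProb_mul_log_choose hβ 0
    simp only [shiftedLogOdds_zero] at h1
    -- The entropy of the weight lies between 0 and log(n+1), so it does not affect the rate.
    have h2 : Tendsto (fun n : ℕ => (∑ w ∈ Finset.range (n + 1),
        weightProb (logOdds β n) w * Real.log (weightProb (logOdds β n) w)) / n) atTop (𝓝 0) := by
      have hneg := tendsto_log_succ_div.neg
      rw [neg_zero] at hneg
      have hQ : ∀ n : ℕ, ∀ w ∈ Finset.range (n + 1), 0 < weightProb (logOdds β n) w :=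
        fun n w hw => weightProb_pos _ (Nat.lt_succ_iff.1 (Finset.mem_range.1 hw))
      refine tendsto_of_tendsto_of_tendsto_of_le_of_le hneg tendsto_const_nhds
        (fun n => ?_) fun n => ?_
      · have := neg_log_card_le_sum_mul_log (hQ n) (sum_weightProb _)
        rw [Finset.card_range] at this
        push_cast at this
        beta_reduce
        rw [← neg_div]
        gcongr
      · exact div_nonpos_of_nonpos_of_nonneg (sum_mul_log_nonpos (hQ n) (sum_weightProb _))
          n.cast_nonneg
    simpa using h1.sub h2
  · simp only [renyiEntropy_hardNoise_of_ne β _ h, mul_div_assoc]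
    exact (tendsto_log_sum_hardTerm hβ hα).const_mul _

/-- The order of the exponents and the sign of 1/(1-α) both reverse at α = 1, so the rates compare
the same way on both sides. -/
theorem softRate_lt_hardRate {β α : ℝ} (hβ : 0 < β) (hα : 0 < α) :
    softRate β α < hardRate β α := by
  unfold softRate hardRate
  split_ifs with h
  · exact integral_binEntropy_sigmoid_lt hβ.ne' 0
  · rcases lt_or_gt_of_ne h with h1 | h1
    · have := softExponent_lt_hardExponent hβ hα h1
      have : 0 < 1 / (1 - α) := one_div_pos.2 (by linarith)
      gcongr
    · have := hardExponent_lt_softExponent hβ h1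
      exact mul_lt_mul_of_neg_left (by linarith) (one_div_neg.2 (by linarith))

/-! ### Capacities -/

theorem output_pos {A B : Type*} [Fintype A] {W : A → B → ℝ} (hW : ∀ a b, 0 < W a b) {p : A → ℝ}
    (hp : p ∈ stdSimplex ℝ A) (b : B) : 0 < ∑ a, p a * W a b := by
  have hex : ∃ a ∈ Finset.univ, 0 < p a := by
    refine Finset.exists_lt_of_sum_lt (f := fun _ => (0 : ℝ)) ?_
    rw [Finset.sum_const_zero, hp.2]
    exact one_pos
  obtain ⟨a, ha, hpa⟩ := hex
  exact Finset.sum_pos' (fun a _ => mul_nonneg (hp.1 a) (hW a b).le)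
    ⟨a, ha, mul_pos hpa (hW a b)⟩

/-- Output entropy minus conditional entropy, in nats; positivity of `W` allows splitting the
logarithm. -/
theorem mutualInfo_mul_log_two {A B : Type*} [Fintype A] [Fintype B] {W : A → B → ℝ}
    (hW : ∀ a b, 0 < W a b) {p : A → ℝ}
    (hp : p ∈ stdSimplex ℝ A) :
    mutualInfo W p * Real.log 2 = ∑ a, p a * ∑ b, W a b * Real.log (W a b)
      - ∑ b, (∑ a, p a * W a b) * Real.log (∑ a, p a * W a b) := by
  have hl : Real.log 2 ≠ 0 := (Real.log_pos one_lt_two).ne'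
  have h2 : ∑ b, (∑ a, p a * W a b) * Real.log (∑ a, p a * W a b)
      = ∑ a, ∑ b, p a * W a b * Real.log (∑ a, p a * W a b) := by
    rw [Finset.sum_comm]
    exact Finset.sum_congr rfl fun b _ => Finset.sum_mul _ _ _
  rw [h2, mutualInfo, Finset.sum_mul, ← Finset.sum_sub_distrib]
  refine Finset.sum_congr rfl fun a _ => ?_
  rw [Finset.sum_mul, Finset.mul_sum, ← Finset.sum_sub_distrib]
  refine Finset.sum_congr rfl fun b _ => ?_
  rw [Real.logb, Real.log_div (hW a b).ne' (output_pos hW hp b).ne']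
  field_simp

theorem uniform_mem_stdSimplex {A : Type*} [Fintype A] [Nonempty A] :
    (fun _ : A => 1 / (Fintype.card A : ℝ)) ∈ stdSimplex ℝ A := by
  refine ⟨fun _ => by positivity, ?_⟩
  have : (Fintype.card A : ℝ) ≠ 0 := by exact_mod_cast Fintype.card_ne_zero
  simp [this]

theorem sum_output_eq_one {A : Type*} [Fintype A] [AddCommGroup A] {W : A → A → ℝ}
    {P : A → ℝ} (hW : ∀ a e, W a (a + e) = P e) (hsum : ∑ e, P e = 1) {p : A → ℝ}
    (hp : p ∈ stdSimplex ℝ A) : ∑ b, ∑ a, p a * W a b = 1 := by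
  rw [Finset.sum_comm]
  have h : ∀ a, ∑ b, p a * W a b = p a := fun a => by
    rw [← Finset.mul_sum, ← Equiv.sum_comp (Equiv.addLeft a)]
    simp [hW, hsum]
  simp only [h, hp.2]

/-- Mutual information of a channel with additive noise. -/
theorem mutualInfo_additive {A : Type*} [Fintype A] [AddCommGroup A] {W : A → A → ℝ}
    {P : A → ℝ} (hW : ∀ a e, W a (a + e) = P e) (hP : ∀ e, 0 < P e) {p : A → ℝ}
    (hp : p ∈ stdSimplex ℝ A) :
    mutualInfo W p * Real.log 2 = -renyiEntropy 1 P
      - ∑ b, (∑ a, p a * W a b) * Real.log (∑ a, p a * W a b) := by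
  have hWpos : ∀ a b, 0 < W a b := fun a b => by
    have := hW a (b - a)
    rw [add_sub_cancel] at this
    rw [this]
    exact hP _
  have h : ∀ a, ∑ b, W a b * Real.log (W a b) = ∑ e, P e * Real.log (P e) := fun a => by
    rw [← Equiv.sum_comp (Equiv.addLeft a)]
    simp [hW]
  rw [mutualInfo_mul_log_two hWpos hp, renyiEntropy, if_pos rfl, neg_neg]
  simp only [h, ← Finset.sum_mul, hp.2, one_mul]

theorem mutualInfo_additive_le {A : Type*} [Fintype A] [AddCommGroup A] {W : A → A → ℝ}
    {P : A → ℝ} (hW : ∀ a e, W a (a + e) = P e) (hP : ∀ e, 0 < P e)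
    (hsum : ∑ e, P e = 1) {p : A → ℝ} (hp : p ∈ stdSimplex ℝ A) :
    mutualInfo W p ≤ (Real.log (Fintype.card A) - renyiEntropy 1 P) / Real.log 2 := by
  have hWpos : ∀ a b, 0 < W a b := fun a b => by
    have := hW a (b - a)
    rw [add_sub_cancel] at this
    rw [this]
    exact hP _
  rw [le_div_iff₀ (Real.log_pos one_lt_two), mutualInfo_additive hW hP hp]
  have := neg_log_card_le_sum_mul_log (S := Finset.univ) (fun b _ => output_pos hWpos hp b)
    (sum_output_eq_one hW hsum hp)
  rw [Finset.card_univ] at this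
  linarith

theorem mutualInfo_additive_uniform {A : Type*} [Fintype A] [AddCommGroup A] {W : A → A → ℝ}
    {P : A → ℝ} (hW : ∀ a e, W a (a + e) = P e) (hP : ∀ e, 0 < P e)
    (hsum : ∑ e, P e = 1) :
    mutualInfo W (fun _ => 1 / (Fintype.card A : ℝ))
      = (Real.log (Fintype.card A) - renyiEntropy 1 P) / Real.log 2 := by
  rw [eq_div_iff (Real.log_pos one_lt_two).ne', mutualInfo_additive hW hP uniform_mem_stdSimplex]
  -- For fixed output b, the noise b - a runs over the whole group, so a uniform input gives a
  -- uniform output.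
  have h : ∀ b, ∑ a, W a b = 1 := fun b => by
    rw [← hsum, ← Equiv.sum_comp (Equiv.subLeft b)]
    refine Finset.sum_congr rfl fun e _ => ?_
    have := hW (b - e) e
    rwa [sub_add_cancel] at this
  have : (Fintype.card A : ℝ) ≠ 0 := by exact_mod_cast Fintype.card_ne_zero
  simp only [← Finset.mul_sum, h, mul_one, Finset.sum_const, Finset.card_univ, nsmul_eq_mul,
    one_div, Real.log_inv]
  field_simp
  ring

theorem capacity_additive {A : Type*} [Fintype A] [AddCommGroup A] {W : A → A → ℝ}
    {P : A → ℝ} (hW : ∀ a e, W a (a + e) = P e) (hP : ∀ e, 0 < P e)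
    (hsum : ∑ e, P e = 1) :
    capacity W = (Real.log (Fintype.card A) - renyiEntropy 1 P) / Real.log 2 := by
  refine IsGreatest.csSup_eq ⟨⟨_, uniform_mem_stdSimplex,
    mutualInfo_additive_uniform hW hP hsum⟩, ?_⟩
  rintro _ ⟨p, hp, rfl⟩
  exact mutualInfo_additive_le hW hP hsum hp

theorem log_card_words (n : ℕ) :
    Real.log (Fintype.card (Fin n → ZMod 2)) = n * Real.log 2 := by
  simp [ZMod.card]

theorem sum_hardNoise (β : ℝ) (n : ℕ) : ∑ e, hardNoise β n e = 1 := by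
  rw [sum_fiberwise_weight]
  simp only [sum_hardNoise_weight_eq, sum_weightProb]

theorem capacity_hardChannel (β : ℝ) (n : ℕ) :
    capacity (hardChannel β n)
      = (n * Real.log 2 - renyiEntropy 1 (hardNoise β n)) / Real.log 2 := by
  rw [capacity_additive (hardChannel_add β n) (hardNoise_pos β n) (sum_hardNoise β n),
    log_card_words]

/-- The permutation is independent of the input, so 1/n! cancels in the likelihood ratio and the
information is an average over permutations. -/
theorem mutualInfo_softChannel (β : ℝ) (n : ℕ) (p : (Fin n → ZMod 2) → ℝ) :
    mutualInfo (softChannel β n) p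
      = ∑ τ : Equiv.Perm (Fin n), 1 / (n.factorial : ℝ) * mutualInfo (transition β n τ) p := by
  have hf : (n.factorial : ℝ) ≠ 0 := by exact_mod_cast n.factorial_ne_zero
  simp only [mutualInfo, Fintype.sum_prod_type_right, softChannel, Finset.mul_sum]
  rw [Finset.sum_comm]
  refine Finset.sum_congr rfl fun τ _ => Finset.sum_congr rfl fun x _ =>
    Finset.sum_congr rfl fun y _ => ?_
  have h : ∑ x', p x' * (1 / (n.factorial : ℝ) * transition β n τ x' y)
      = 1 / (n.factorial : ℝ) * ∑ x', p x' * transition β n τ x' y := by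
    rw [Finset.mul_sum]
    exact Finset.sum_congr rfl fun _ _ => by ring
  rw [h, mul_div_mul_left _ _ (one_div_ne_zero hf)]
  ring

/-- The uniform input is optimal for every permutation simultaneously, and the noise entropy is the
same for all of them; the identity serves as representative. -/
theorem capacity_softChannel (β : ℝ) (n : ℕ) :
    capacity (softChannel β n)
      = (n * Real.log 2 - renyiEntropy 1 (softNoise β n 1)) / Real.log 2 := by
  have hf : (n.factorial : ℝ) ≠ 0 := by exact_mod_cast n.factorial_ne_zero
  have hent : ∀ τ, renyiEntropy 1 (softNoise β n τ) = renyiEntropy 1 (softNoise β n 1) :=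
    fun τ => by simp only [renyiEntropy_softNoise_one]
  have hpos : ∀ τ e, 0 < softNoise β n τ e := fun τ e => by
    rw [softNoise_eq_wordProb]; exact wordProb_pos _ e
  have hsum : ∀ τ, ∑ e, softNoise β n τ e = 1 := fun τ => by
    rw [softNoise_eq_wordProb]; exact sum_wordProb _
  have havg : ∀ x : ℝ, ∑ _τ : Equiv.Perm (Fin n), 1 / (n.factorial : ℝ) * x = x := fun x => by
    rw [Finset.sum_const, Finset.card_univ, Fintype.card_perm, Fintype.card_fin, nsmul_eq_mul]
    field_simp
  refine IsGreatest.csSup_eq ⟨⟨_, uniform_mem_stdSimplex, ?_⟩, ?_⟩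
  · rw [mutualInfo_softChannel]
    refine (Finset.sum_congr rfl fun τ _ => ?_).trans (havg _)
    rw [mutualInfo_additive_uniform (transition_add β n τ) (hpos τ) (hsum τ), hent,
      log_card_words]
  · rintro _ ⟨p, hp, rfl⟩
    rw [mutualInfo_softChannel]
    refine (Finset.sum_le_sum fun τ _ => ?_).trans_eq (havg _)
    have := mutualInfo_additive_le (transition_add β n τ) (hpos τ) (hsum τ) hp
    rw [hent, log_card_words] at this
    gcongr

theorem tendsto_capacity_div {H : ℕ → ℝ} {h : ℝ}
    (hH : Tendsto (fun n : ℕ => H n / n) atTop (𝓝 h)) :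
    Tendsto (fun n : ℕ => (n * Real.log 2 - H n) / Real.log 2 / n) atTop
      (𝓝 (1 - h / Real.log 2)) := by
  have hl : Real.log 2 ≠ 0 := (Real.log_pos one_lt_two).ne'
  refine ((hH.div_const (Real.log 2)).const_sub 1).congr' ?_
  filter_upwards [eventually_gt_atTop 0] with n hn
  have : (n : ℝ) ≠ 0 := by exact_mod_cast hn.ne'
  field_simp

end

end LRC

/-! ### Rates and capacities combined -/

theorem mainTheorem5 (β : ℝ) (hβ : 0 < β) :
    ∃ HN HZ : ℝ → ℝ,
      (∀ α : ℝ, 0 < α →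
        (∀ τ : (n : ℕ) → Equiv.Perm (Fin n),
          LRC.HasRenyiEntropyRate (fun n => LRC.softNoise β n (τ n)) α (HN α)) ∧
        LRC.HasRenyiEntropyRate (fun n => LRC.hardNoise β n) α (HZ α) ∧
        HN α < HZ α) ∧
      ∃ CN CZ : ℝ,
        LRC.HasCapacity (fun n => LRC.softChannel β n) CN ∧
        LRC.HasCapacity (fun n => LRC.hardChannel β n) CZ ∧
        CN = 1 - HN 1 / Real.log 2 ∧
        CZ = 1 - HZ 1 / Real.log 2 ∧
        CZ < CN := by
  refine ⟨LRC.softRate β, LRC.hardRate β, fun α hα =>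
    ⟨LRC.hasRenyiEntropyRate_softNoise β α, LRC.hasRenyiEntropyRate_hardNoise hβ hα,
      LRC.softRate_lt_hardRate hβ hα⟩, _, _, ?_, ?_, rfl, rfl, ?_⟩
  · simp only [LRC.HasCapacity, LRC.capacity_softChannel]
    exact LRC.tendsto_capacity_div (LRC.hasRenyiEntropyRate_softNoise β 1 fun _ => 1)
  · simp only [LRC.HasCapacity, LRC.capacity_hardChannel]
    exact LRC.tendsto_capacity_div (LRC.hasRenyiEntropyRate_hardNoise hβ one_pos)
  · have hl := Real.log_pos one_lt_two
    have := LRC.softRate_lt_hardRate hβ one_pos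
    gcongr
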